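/- Let $H$ be a finite group and let $S\subseteq H$ satisfy $1\notin S$ and $S=S^{-1}$. Let $\Gamma={\rm Cay}(H,S)$ be the Cayley graph of $H$ with respect to $S$, that is, the simple undirected graph with vertex set $H$ in which each $h\in H$ is adjacent to $sh$ for all $s\in S$ ($S$ is not required to generate $H$). Suppose that $\Gamma$ is normal, meaning that the group $R(H)$ of all right translations $x\mapsto xa$ ($a\in H$) is a normal subgroup of the automorphism group ${\rm Aut}(\Gamma)$. If $H$ is not isomorphic to any of the four elementary abelian groups $C_2^2$, $C_2^3$, $C_3^2$, $C_2^4$ (of orders $4$, $8$, $9$, $16$) or to the quaternion group $Q_8$ of order $8$, then $D(\Gamma)\le 3$. Here the distinguishing number $D(\Gamma)$ is the least $r$ for which there is a labelling $\phi:V(\Gamma)\to\{1,\dots,r\}$ such that for every non-identity $\sigma\in{\rm Aut}(\Gamma)$ there is a vertex $x$ with $\phi(x)\ne\phi(\sigma(x))$. -/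

import Mathlib

/-- The Cayley graph `Cay(H, S)` of a group `H` with respect to a subset `S` with `1 ∉ S` that is
closed under inverses: the vertices are the elements of `H`, and `h` is adjacent to `s * h`
for all `h ∈ H` and `s ∈ S`. -/
def cayleyGraph {H : Type*} [Group H] (S : Set H) (h1 : (1 : H) ∉ S)
    (hinv : ∀ s ∈ S, s⁻¹ ∈ S) : SimpleGraph H where
  Adj h g := ∃ s ∈ S, g = s * h
  symm := ⟨by
    rintro h g ⟨s, hs, rfl⟩
    exact ⟨s⁻¹, hinv s hs, by simp⟩⟩
  loopless := ⟨by
    rintro h ⟨s, hs, hh⟩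
    have : s = 1 := by simpa using hh.symm
    exact h1 (this ▸ hs)⟩

/-- Right translation `x ↦ x * a⁻¹`, as a homomorphism from `H` into the automorphism group of
`Cay(H, S)`. -/
def rightTranslation {H : Type*} [Group H] (S : Set H) (h1 : (1 : H) ∉ S)
    (hinv : ∀ s ∈ S, s⁻¹ ∈ S) :
    H →* (cayleyGraph S h1 hinv ≃g cayleyGraph S h1 hinv) where
  toFun a :=
    { toEquiv := Equiv.mulRight a⁻¹
      map_rel_iff' := by
        intro x y
        simp [cayleyGraph, ← mul_assoc] }
  map_one' := by
    ext x
    simp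
  map_mul' a b := by
    ext x
    change x * (a * b)⁻¹ = x * b⁻¹ * a⁻¹
    simp [mul_assoc]

/-- The right regular representation `R(H)`: the group of all right translations of `H`, as a
subgroup of the automorphism group of `Cay(H, S)`. -/
def rightRegularRep {H : Type*} [Group H] (S : Set H) (h1 : (1 : H) ∉ S)
    (hinv : ∀ s ∈ S, s⁻¹ ∈ S) :
    Subgroup (cayleyGraph S h1 hinv ≃g cayleyGraph S h1 hinv) :=
  (rightTranslation S h1 hinv).range

/-- The Cayley graph `Cay(H, S)` is normal if `R(H)` is a normal subgroup of its automorphism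
group. -/
def IsNormalCayley {H : Type*} [Group H] (S : Set H) (h1 : (1 : H) ∉ S)
    (hinv : ∀ s ∈ S, s⁻¹ ∈ S) : Prop :=
  (rightRegularRep S h1 hinv).Normal

/-- A vertex labelling with `r` labels is distinguishing if every non-identity automorphism of the
graph changes the label of some vertex. -/
def IsDistinguishing {V : Type*} (G : SimpleGraph V) {r : ℕ} (φ : V → Fin r) : Prop :=
  ∀ σ : G ≃g G, σ ≠ 1 → ∃ x, φ x ≠ φ (σ x)

/-- The distinguishing number of a graph: the least number `r` such that the graph has a
distinguishing labelling with `r` labels (`⊤` if there is no such finite `r`). -/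
noncomputable def distinguishingNumber {V : Type*} (G : SimpleGraph V) : ℕ∞ :=
  ⨅ r ∈ {r : ℕ | ∃ φ : V → Fin r, IsDistinguishing G φ}, (r : ℕ∞)

/-! Normality makes every automorphism of the graph that fixes `1` a group automorphism. It
therefore suffices to find a set `Y` that no non-identity group automorphism preserves
(`HasRigidSet`): give `1` a label of its own, and separate `Y` from its complement with the other
two labels. The theorem reduces to `hasRigidSet_of_isEmpty`: apart from the five exceptions, every
finite group has such a set.

The main tool is heredity. A rigid set `Z` of a subgroup `M` with `3 ≤ |Z|` and `2|Z| + 2 < |M|`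
gives a rigid set of `⟨M, t⟩`, namely `(M \ Z) ∪ {t}`, within the same kind of bounds: more than
half of `M` lies in the set, which forces an automorphism preserving it to preserve `M`. Hence a
small rigid set in any subgroup yields one in the whole group (`HasSmallRigidSet.of_subgroup`), and
only groups all of whose subgroups lack one need attention.

Let `G` be such a group. Explicit sets in two-generator subgroups show that if `a` has order at
least 4 and `b ∉ ⟨a⟩`, then `a` has order 4 and `⟨a, b⟩` has order 8
(`orderOf_eq_four_and_card_closure_pair`). So an element of order above 4 makes `G` cyclic. If the
maximal order is 4, all squares lie in `{1, z}` with `z` a central involution, and explicit sets in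
three-generator subgroups show that `G` has two generators (`exists_closure_pair_eq_top`); what
remains is `C₄`, or order 8, where only `Q₈` escapes. If all orders are at most 3, then orders 2 and
3 together leave only a group generated by one element of each order, exponent 3 forces
commutativity, and elementary abelian groups are settled by explicit sets in `C₃³` and `C₂⁵`,
leaving the small ranks as exceptions. -/

/-! ### Small rigid sets and their passage to overgroups -/

/-- A group has a small rigid subset if some subset `Y` with `3 ≤ |Y|` and `2 * |Y| + 2 < |G|` is
mapped into itself by no automorphism of the group except the identity. -/
def HasSmallRigidSet (G : Type*) [Group G] : Prop :=
  ∃ Y : Set G, 3 ≤ Y.ncard ∧ 2 * Y.ncard + 2 < Nat.card G ∧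
    ∀ σ : G ≃* G, Set.MapsTo σ Y Y → ∀ x, σ x = x

theorem HasSmallRigidSet.of_mulEquiv {G K : Type*} [Group G] [Group K] (e : K ≃* G)
    (h : HasSmallRigidSet K) : HasSmallRigidSet G := by
  obtain ⟨Y, h3, hc, hY⟩ := h
  refine ⟨e '' Y, ?_, ?_, fun σ hσ x => ?_⟩
  · rwa [Set.ncard_image_of_injective _ e.injective]
  · rwa [Set.ncard_image_of_injective _ e.injective, ← Nat.card_congr e.toEquiv]
  · have := hY ((e.trans σ).trans e.symm) (by
      intro y hy
      obtain ⟨y', hy', h⟩ := hσ ⟨y, hy, rfl⟩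
      have : e.symm (σ (e y)) = y' := by rw [← h]; simp
      simpa [this] using hy') (e.symm x)
    simpa [MulEquiv.symm_apply_eq] using this

theorem Set.MapsTo.symm_mapsTo {G : Type*} [Finite G] {σ : G ≃ G} {Y : Set G}
    (h : Set.MapsTo σ Y Y) : Set.MapsTo σ.symm Y Y := by
  have h1 : σ '' Y = Y :=
    Set.eq_of_subset_of_ncard_le h.image_subset
      (Set.ncard_image_of_injective _ σ.injective).ge Y.toFinite
  intro y hy
  rw [← h1] at hy
  obtain ⟨x, hx, rfl⟩ := hy
  simpa using hx

/-- A small rigid set of a subgroup `M` gives one of the subgroup generated by `M` and `t ∉ M`: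
the complement of the set in `M`, together with `t`. -/
theorem HasSmallRigidSet.of_insert {G : Type*} [Group G] [Finite G] (M : Subgroup G) (t : G)
    (ht : t ∉ M) (hgen : M ⊔ Subgroup.zpowers t = ⊤) (h : HasSmallRigidSet M) :
    HasSmallRigidSet G := by
  obtain ⟨Y', h3, hc, hY⟩ := h
  set Z : Set G := (↑) '' Y' with hZ
  have hZc : Z.ncard = Y'.ncard := Set.ncard_image_of_injective _ Subtype.val_injective
  have hZM : Z ⊆ M := by rintro _ ⟨x, _, rfl⟩; exact x.2
  have hMc : (M : Set G).ncard = Nat.card M := rfl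
  have hD : ((M : Set G) \ Z).ncard + Z.ncard = Nat.card M := by
    rw [Set.ncard_sdiff_add_ncard_of_subset hZM, hMc]
  have hYc : (insert t ((M : Set G) \ Z)).ncard = ((M : Set G) \ Z).ncard + 1 :=
    Set.ncard_insert_of_notMem fun h => ht h.1
  have hMG : 2 * Nat.card M ≤ Nat.card G := by
    rw [← M.card_mul_index, mul_comm]
    refine Nat.mul_le_mul_left _ ?_
    have h1 : M.index ≠ 1 := fun h => ht (by rw [Subgroup.index_eq_one.1 h]; trivial)
    have h0 : M.index ≠ 0 := Subgroup.index_ne_zero_of_finite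
    omega
  -- The new set has `|M| - |Z| + 1` elements: `2|Z| + 2 < |M|` bounds this below, and `3 ≤ |Z|`
  -- with `2|M| ≤ |G|` bounds it above.
  refine ⟨insert t ((M : Set G) \ Z), by omega, by omega, fun σ hσ => ?_⟩
  -- All of `σ (M \ Z)` except possibly the element `t` lies in `σ M ∩ M`, so this subgroup has at
  -- least `|M| - |Z| - 1 > |M| / 2` elements and is `M` by Lagrange. The summand `+ 2` in the
  -- definition pays for this `t`.
  have hcap : (M.map σ.toMonoidHom ⊓ M) = M := by
    have hsub : σ '' ((M : Set G) \ Z) ⊆ insert t ((M.map σ.toMonoidHom ⊓ M : Subgroup G) : Set G) := by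
      rintro _ ⟨x, hx, rfl⟩
      rcases hσ (Set.mem_insert_of_mem _ hx) with h | h
      · exact Or.inl h
      · exact Or.inr ⟨⟨x, hx.1, rfl⟩, h.1⟩
    have h1 := Set.ncard_le_ncard hsub (Set.toFinite _)
    have h2 := Set.ncard_insert_le t ((M.map σ.toMonoidHom ⊓ M : Subgroup G) : Set G)
    rw [Set.ncard_image_of_injective _ σ.injective] at h1
    have h4 : ((M.map σ.toMonoidHom ⊓ M : Subgroup G) : Set G).ncard
      = Nat.card (M.map σ.toMonoidHom ⊓ M : Subgroup G) := rfl
    have hle : M.map σ.toMonoidHom ⊓ M ≤ M := inf_le_right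
    obtain ⟨k, hk⟩ := Subgroup.card_dvd_of_le hle
    have hpos : 0 < Nat.card M := Nat.card_pos
    have hk1 : k = 1 := by
      rcases k with _ | _ | k
      · omega
      · rfl
      · nlinarith
    rw [hk1, mul_one] at hk
    exact Subgroup.eq_of_le_of_card_ge hle hk.le
  have hM : M.map σ.toMonoidHom = M := by
    refine (Subgroup.eq_of_le_of_card_ge (inf_eq_right.1 hcap) ?_).symm
    rw [Subgroup.card_map_of_injective σ.injective]
  have hmem : ∀ x, σ x ∈ M ↔ x ∈ M := fun x => by
    constructor
    · intro h
      rw [← hM] at h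
      obtain ⟨y, hy, hyx⟩ := h
      rwa [← σ.injective hyx]
    · intro h
      rw [← hM]
      exact ⟨x, h, rfl⟩
  have htσ : σ t = t := by
    rcases hσ (Set.mem_insert _ _) with h | h
    · exact h
    · exact absurd ((hmem t).1 h.1) ht
  have hsymm := Set.MapsTo.symm_mapsTo (σ := σ.toEquiv) hσ
  have hZσ : ∀ x ∈ Z, σ x ∈ Z := by
    intro x hx
    by_contra hn
    have h2 := hsymm (Set.mem_insert_of_mem t ⟨(hmem x).2 (hZM hx), hn⟩)
    have h3 : σ.toEquiv.symm (σ x) = x := σ.symm_apply_apply x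
    rw [h3] at h2
    rcases h2 with h | h
    · exact ht (h ▸ hZM hx)
    · exact h.2 hx
  let τ : M ≃* M := (σ.subgroupMap M).trans (MulEquiv.subgroupCongr hM)
  have hτ : ∀ x : M, (τ x : G) = σ x := fun x => rfl
  have hfix := hY τ (by
    intro y hy
    obtain ⟨y', hy', h⟩ := hZσ y ⟨y, hy, rfl⟩
    have : τ y = y' := Subtype.ext (by rw [hτ, h])
    rwa [this])
  have hle : M ⊔ Subgroup.zpowers t ≤ σ.toMonoidHom.eqLocus (MonoidHom.id G) := by
    refine sup_le (fun x hx => ?_) ?_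
    · have := congrArg Subtype.val (hfix ⟨x, hx⟩)
      exact this
    · rw [Subgroup.zpowers_le]
      exact htσ
  intro x
  exact hle (hgen ▸ Subgroup.mem_top x)

theorem HasSmallRigidSet.of_subgroup {G : Type*} [Group G] [Finite G] (K : Subgroup G)
    (h : HasSmallRigidSet K) : HasSmallRigidSet G := by
  induction hn : K.index using Nat.strong_induction_on generalizing K with
  | _ n ih =>
    by_cases hK : K = ⊤
    · subst hK
      exact h.of_mulEquiv Subgroup.topEquiv
    · obtain ⟨t, ht⟩ : ∃ t, t ∉ K := by
        by_contra! hall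
        exact hK ((Subgroup.eq_top_iff' K).2 hall)
      set L := K ⊔ Subgroup.zpowers t with hL
      have hKL : K ≤ L := le_sup_left
      have htL : t ∈ L := (le_sup_right : _ ≤ L) (Subgroup.mem_zpowers t)
      have hlt : K < L := lt_of_le_of_ne hKL fun he => ht (he ▸ htL)
      refine ih L.index ?_ L ?_ rfl
      · rw [← hn]
        exact Subgroup.index_strictAnti hlt
      · refine HasSmallRigidSet.of_insert (K.subgroupOf L) ⟨t, htL⟩ ?_ ?_
          (h.of_mulEquiv (Subgroup.subgroupOfEquivOfLe hKL).symm)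
        · simpa [Subgroup.mem_subgroupOf] using ht
        · apply Subgroup.map_injective L.subtype_injective
          rw [Subgroup.map_sup, Subgroup.subgroupOf_map_subtype, MonoidHom.map_zpowers,
            inf_eq_left.2 hKL, ← MonoidHom.range_eq_map, Subgroup.range_subtype]
          rfl

theorem HasSmallRigidSet.of_injective {G K : Type*} [Group G] [Finite G] [Group K] (f : K →* G)
    (hf : Function.Injective f) (h : HasSmallRigidSet K) : HasSmallRigidSet G :=
  .of_subgroup f.range (h.of_mulEquiv (MonoidHom.ofInjective hf))

/-! ### Small rigid sets from generators -/

/-- A finite set `Y` is a small rigid set of the subgroup it generates if it is small enough and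
its elements are fixed by every partial automorphism that preserves `Y`. -/
theorem hasSmallRigidSet_of_closure {G : Type*} [Group G] [Finite G] (Y : Finset G)
    (h3 : 3 ≤ Y.card) (K : Subgroup G) (hYK : (Y : Set G) ⊆ K)
    (hKY : K ≤ Subgroup.closure (Y : Set G)) (hc : 2 * Y.card + 2 < Nat.card K)
    (hfix : ∀ f : G → G, (∀ x ∈ K, ∀ y ∈ K, f (x * y) = f x * f y) →
      (∀ x ∈ K, ∀ y ∈ K, f x = f y → x = y) → (∀ y ∈ Y, f y ∈ Y) →
      (∀ y ∈ Y, ∃ u ∈ Y, f u = y) → ∀ y ∈ Y, f y = y) :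
    HasSmallRigidSet G := by
  classical
  have hK : K = Subgroup.closure (Y : Set G) := le_antisymm hKY ((Subgroup.closure_le K).2 hYK)
  have hcard : ((↑) ⁻¹' (Y : Set G) : Set K).ncard = Y.card := by
    have himage : K.subtype '' ((↑) ⁻¹' (Y : Set G) : Set K) = Y := by
      ext y
      simpa using fun h => hYK h
    rw [← Set.ncard_image_of_injective _ K.subtype_injective, himage, Set.ncard_coe_finset]
  refine .of_subgroup K ⟨(↑) ⁻¹' (Y : Set G), by omega, by omega, fun σ hσ => ?_⟩
  -- The value outside `K` is arbitrary: working with a total function on `G` avoids subtypes, and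
  -- multiplicativity and injectivity are only claimed on `K`.
  let f : G → G := fun x => if h : x ∈ K then σ ⟨x, h⟩ else x
  have hf : ∀ x (h : x ∈ K), f x = σ ⟨x, h⟩ := fun x h => dif_pos h
  have hinj : ∀ x ∈ K, ∀ y ∈ K, f x = f y → x = y := fun x hx y hy h => by
    rw [hf x hx, hf y hy] at h
    simpa using h
  have hmaps : ∀ y ∈ Y, f y ∈ Y := fun y hy => by
    rw [hf y (hYK hy)]
    exact hσ (show (⟨y, hYK hy⟩ : K) ∈ ((↑) ⁻¹' (Y : Set G) : Set K) from hy)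
  have key := hfix f (fun x hx y hy => by
      rw [hf x hx, hf y hy, hf _ (K.mul_mem hx hy), ← Subgroup.coe_mul, ← map_mul]; rfl)
    hinj hmaps (Finset.surjOn_of_injOn_of_card_le f hmaps
      (fun x hx y hy h => hinj x (hYK hx) y (hYK hy) h) le_rfl)
  have hle : (⊤ : Subgroup K) ≤ σ.toMonoidHom.eqLocus (MonoidHom.id K) := by
    subst hK
    rw [← Subgroup.closure_closure_coe_preimage, Subgroup.closure_le]
    intro y hy
    have := key y hy
    rw [hf _ y.2] at this
    exact Subtype.ext this
  exact fun x => hle (Subgroup.mem_top x)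

section PartialAutomorphism

variable {G : Type*} [Group G] {K : Subgroup G} {f : G → G}

theorem partialHom_one (hmul : ∀ x ∈ K, ∀ y ∈ K, f (x * y) = f x * f y) : f 1 = 1 := by
  have := hmul 1 K.one_mem 1 K.one_mem
  simpa using this

theorem partialHom_pow (hmul : ∀ x ∈ K, ∀ y ∈ K, f (x * y) = f x * f y) {x : G} (hx : x ∈ K)
    (n : ℕ) : f (x ^ n) = f x ^ n := by
  induction n with
  | zero => simpa using partialHom_one hmul
  | succ n ih => rw [pow_succ, hmul _ (K.pow_mem hx n) _ hx, ih, pow_succ]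

theorem partialHom_ne_one (hmul : ∀ x ∈ K, ∀ y ∈ K, f (x * y) = f x * f y)
    (hinj : ∀ x ∈ K, ∀ y ∈ K, f x = f y → x = y) {x : G} (hx : x ∈ K) (h : x ≠ 1) : f x ≠ 1 :=
  fun h1 => h (hinj x hx 1 K.one_mem (h1.trans (partialHom_one hmul).symm))

theorem orderOf_partialHom (hmul : ∀ x ∈ K, ∀ y ∈ K, f (x * y) = f x * f y)
    (hinj : ∀ x ∈ K, ∀ y ∈ K, f x = f y → x = y) {x : G} (hx : x ∈ K) :
    orderOf (f x) = orderOf x := by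
  rw [orderOf_eq_orderOf_iff]
  intro n
  rw [← partialHom_pow hmul hx]
  constructor
  · intro h
    by_contra hn
    exact partialHom_ne_one hmul hinj (K.pow_mem hx n) hn h
  · intro h
    rw [h, partialHom_one hmul]

end PartialAutomorphism

/-! ### Two generators, one of order at least four -/

theorem mem_closure_pair_left {G : Type*} [Group G] (a b : G) :
    a ∈ Subgroup.closure ({a, b} : Set G) :=
  Subgroup.subset_closure (by simp)

theorem mem_closure_pair_right {G : Type*} [Group G] (a b : G) :
    b ∈ Subgroup.closure ({a, b} : Set G) :=
  Subgroup.subset_closure (by simp)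

section TwoGenerators

variable {G : Type*} [Group G] {a b : G}

/-- The set is `{1, a, b}`: its three elements have distinct orders. The element `1` serves only to
reach size 3, and `9 > 2 * 3 + 2`. -/
theorem hasSmallRigidSet_of_orderOf_ne [Finite G] (ha : a ≠ 1) (hb : b ≠ 1)
    (hab : orderOf a ≠ orderOf b) (hc : 9 ≤ Nat.card (Subgroup.closure ({a, b} : Set G))) :
    HasSmallRigidSet G := by
  classical
  have hne : a ≠ b := fun h => hab (h ▸ rfl)
  have hcard : ({1, a, b} : Finset G).card = 3 := by
    rw [Finset.card_eq_three]
    exact ⟨_, _, _, ha.symm, hb.symm, hne, rfl⟩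
  have haK := mem_closure_pair_left a b
  have hbK := mem_closure_pair_right a b
  refine hasSmallRigidSet_of_closure {1, a, b} (by omega) (Subgroup.closure {a, b}) ?_ ?_
    (by omega) ?_
  · simp [Set.insert_subset_iff]
  · apply Subgroup.closure_mono
    simp
  · intro f hmul hinj hf _
    have hoa := orderOf_partialHom hmul hinj haK
    have hob := orderOf_partialHom hmul hinj hbK
    have h3 := hf a (by simp)
    have h4 := hf b (by simp)
    simp only [Finset.mem_insert, Finset.mem_singleton] at h3 h4 ⊢
    rintro y (rfl | rfl | rfl)
    · exact partialHom_one hmul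
    · rcases h3 with h | h | h
      · exact absurd h (partialHom_ne_one hmul hinj haK ha)
      · exact h
      · rw [h] at hoa
        exact absurd hoa.symm hab
    · rcases h4 with h | h | h
      · exact absurd h (partialHom_ne_one hmul hinj hbK hb)
      · rw [h] at hob
        exact absurd hob hab
      · exact h

/-- The set is `{1, a, b, a ^ 2}`. The image of `a` must have its square in the set; the hypotheses
exclude `b` and `a ^ 2` as images, so `a` and `a ^ 2` are fixed, and `b` is the only place left for
itself. -/
theorem hasSmallRigidSet_of_sq_ne [Finite G] (ha3 : a ^ 3 ≠ 1) (ha2 : a ^ 2 ≠ 1)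
    (hab : a ∉ Subgroup.zpowers b) (hba : b ∉ Subgroup.zpowers a) (hsq : a ^ 2 ≠ b ^ 2)
    (hc : 11 ≤ Nat.card (Subgroup.closure ({a, b} : Set G))) : HasSmallRigidSet G := by
  classical
  have ha : a ≠ 1 := fun h => ha2 (by simp [h])
  have hb : b ≠ 1 := fun h => hba (h ▸ Subgroup.one_mem _)
  have hne : a ≠ b := fun h => hba (h ▸ Subgroup.mem_zpowers _)
  have haa : a ^ 2 ≠ a := fun h => ha (by rwa [pow_two, mul_eq_left] at h)
  have hb2 : b ≠ a ^ 2 := fun h => hba (h ▸ Subgroup.npow_mem_zpowers _ _)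
  have hcard : ({1, a, b, a ^ 2} : Finset G).card = 4 := by
    rw [Finset.card_insert_of_notMem, Finset.card_insert_of_notMem, Finset.card_insert_of_notMem,
      Finset.card_singleton] <;> simp [*, Ne.symm ha, Ne.symm hb, Ne.symm ha2, haa.symm]
  have haK := mem_closure_pair_left a b
  have hbK := mem_closure_pair_right a b
  refine hasSmallRigidSet_of_closure {1, a, b, a ^ 2} (by omega) (Subgroup.closure {a, b}) ?_ ?_
    (by omega) ?_
  · simp [Set.insert_subset_iff, haK, hbK, Subgroup.pow_mem]
  · apply Subgroup.closure_mono
    simp [Set.insert_subset_iff]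
  · intro f hmul hinj hf _
    have hfa : f a = a := by
      have h3 := hf a (by simp)
      have h4 := hf (a ^ 2) (by simp)
      have h5 : f (a ^ 2) ≠ 1 := partialHom_ne_one hmul hinj (Subgroup.pow_mem _ haK 2) ha2
      rw [partialHom_pow hmul haK] at h4 h5
      simp only [Finset.mem_insert, Finset.mem_singleton] at h3 h4
      rcases h3 with h3 | h3 | h3 | h3
      · exact absurd h3 (partialHom_ne_one hmul hinj haK ha)
      · exact h3
      · rw [h3] at h4 h5
        rcases h4 with h4 | h4 | h4 | h4
        · exact absurd h4 h5
        · exact absurd (h4 ▸ Subgroup.npow_mem_zpowers _ _) hab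
        · rw [pow_two, mul_eq_left] at h4
          exact absurd h4 hb
        · exact absurd h4.symm hsq
      · rw [h3] at h4 h5
        rcases h4 with h4 | h4 | h4 | h4
        · exact absurd h4 h5
        · rw [← pow_mul] at h4
          exact absurd (show a ^ 3 = 1 by
            have : a ^ 3 * a = a := by rw [← pow_succ]; exact h4
            simpa using this) ha3
        · rw [← pow_mul] at h4
          exact absurd (h4 ▸ Subgroup.npow_mem_zpowers _ _) hba
        · rw [pow_two (a ^ 2), mul_eq_left] at h4
          exact absurd h4 ha2
    have hfa2 : f (a ^ 2) = a ^ 2 := by rw [partialHom_pow hmul haK, hfa]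
    have hfb : f b = b := by
      have h3 := hf b (by simp)
      simp only [Finset.mem_insert, Finset.mem_singleton] at h3
      rcases h3 with h | h | h | h
      · exact absurd h (partialHom_ne_one hmul hinj hbK hb)
      · exact absurd (hinj _ hbK _ haK (h.trans hfa.symm)) hne.symm
      · exact h
      · exact absurd (hinj _ hbK _ (Subgroup.pow_mem _ haK 2) (h.trans hfa2.symm)) hb2
    simp only [Finset.mem_insert, Finset.mem_singleton]
    rintro y (rfl | rfl | rfl | rfl)
    exacts [partialHom_one hmul, hfa, hfb, hfa2]

/-- If `b` normalises `⟨a⟩` and `b ^ 2 ∈ ⟨a⟩`, then `⟨a⟩` has index at most two in `⟨a, b⟩`. -/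
theorem mem_zpowers_or_of_mem_closure_pair (hconj : b * a * b⁻¹ ∈ Subgroup.zpowers a)
    (hsq : b ^ 2 ∈ Subgroup.zpowers a) {x : G} (hx : x ∈ Subgroup.closure ({a, b} : Set G)) :
    x ∈ Subgroup.zpowers a ∨ b⁻¹ * x ∈ Subgroup.zpowers a := by
  have hn : ∀ y ∈ Subgroup.zpowers a, b * y * b⁻¹ ∈ Subgroup.zpowers a := by
    rintro _ ⟨k, rfl⟩
    have h := Subgroup.zpow_mem _ hconj k
    rwa [conj_zpow] at h
  have hn' : ∀ y ∈ Subgroup.zpowers a, b⁻¹ * y * b ∈ Subgroup.zpowers a := by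
    intro y hy
    have h := (Subgroup.zpowers a).mul_mem ((Subgroup.zpowers a).mul_mem
      ((Subgroup.zpowers a).inv_mem hsq) (hn y hy)) hsq
    convert h using 1
    group
  have ha := Subgroup.mem_zpowers a
  induction hx using Subgroup.closure_induction_left with
  | one => exact Or.inl (Subgroup.one_mem _)
  | mul_left x hx y _ ih =>
    rcases hx with rfl | rfl <;> rcases ih with h | h
    · exact Or.inl (Subgroup.mul_mem _ ha h)
    · right
      have := Subgroup.mul_mem _ (hn' _ ha) h
      convert this using 1
      group
    · exact Or.inr (by simpa using h)
    · left
      have := Subgroup.mul_mem _ hsq h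
      convert this using 1
      group
  | inv_mul_cancel x hx y _ ih =>
    rcases hx with rfl | rfl <;> rcases ih with h | h
    · exact Or.inl (Subgroup.mul_mem _ (Subgroup.inv_mem _ ha) h)
    · right
      have := Subgroup.mul_mem _ (hn' _ (Subgroup.inv_mem _ ha)) h
      convert this using 1
      group
    · right
      have := Subgroup.mul_mem _ (Subgroup.inv_mem _ hsq) h
      convert this using 1
      group
    · exact Or.inl h

theorem card_closure_pair_le [Finite G] (hconj : b * a * b⁻¹ ∈ Subgroup.zpowers a)
    (hsq : b ^ 2 ∈ Subgroup.zpowers a) :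
    Nat.card (Subgroup.closure ({a, b} : Set G)) ≤ 2 * orderOf a := by
  have hsub : (Subgroup.closure ({a, b} : Set G) : Set G) ⊆
      (Subgroup.zpowers a : Set G) ∪ (fun x => b * x) '' (Subgroup.zpowers a : Set G) := by
    intro x hx
    rcases mem_zpowers_or_of_mem_closure_pair hconj hsq hx with h | h
    · exact Or.inl h
    · exact Or.inr ⟨_, h, by simp⟩
  have h1 := Set.ncard_le_ncard hsub (Set.toFinite _)
  have h2 := Set.ncard_union_le (Subgroup.zpowers a : Set G)
    ((fun x => b * x) '' (Subgroup.zpowers a : Set G))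
  rw [Set.ncard_image_of_injective _ (mul_right_injective b)] at h2
  have h3 : (Subgroup.zpowers a : Set G).ncard = orderOf a := Nat.card_zpowers a
  have h4 : (Subgroup.closure ({a, b} : Set G) : Set G).ncard
    = Nat.card (Subgroup.closure ({a, b} : Set G)) := rfl
  omega

end TwoGenerators

theorem Subgroup.sq_mem_and_conj_mem_of_card_eq {G : Type*} [Group G] [Finite G]
    {K L : Subgroup G} (hKL : K ≤ L) (hc : Nat.card L = 2 * Nat.card K) {x : G} (hx : x ∈ L) :
    x ^ 2 ∈ K ∧ ∀ y ∈ K, x * y * x⁻¹ ∈ K := by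
  have hi : (K.subgroupOf L).index = 2 := by
    have h1 := (K.subgroupOf L).card_mul_index
    rw [Nat.card_congr (Subgroup.subgroupOfEquivOfLe hKL).toEquiv, hc, mul_comm 2] at h1
    exact Nat.eq_of_mul_eq_mul_left Nat.card_pos h1
  refine ⟨Subgroup.sq_mem_of_index_two hi ⟨x, hx⟩, fun y hy => ?_⟩
  exact (Subgroup.normal_of_index_eq_two hi).conj_mem ⟨y, hKL hy⟩ hy ⟨x, hx⟩

theorem Subgroup.exists_card_eq_mul {G : Type*} [Group G] [Finite G] {K L : Subgroup G}
    (h : K < L) : ∃ k, 2 ≤ k ∧ Nat.card L = Nat.card K * k := by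
  obtain ⟨k, hk⟩ := Subgroup.card_dvd_of_le h.le
  refine ⟨k, ?_, hk⟩
  rcases k with _ | _ | k
  · have := Nat.card_pos (α := L)
    omega
  · exact absurd (Subgroup.eq_of_le_of_card_ge h.le (by omega)) h.ne
  · omega

theorem zpowers_lt_closure_pair {G : Type*} [Group G] {a b : G}
    (hb : b ∉ Subgroup.zpowers a) : Subgroup.zpowers a < Subgroup.closure ({a, b} : Set G) := by
  refine lt_of_le_of_ne ?_ fun h => hb (h ▸ mem_closure_pair_right a b)
  rw [Subgroup.zpowers_le]
  exact mem_closure_pair_left a b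

theorem mem_zpowers_comm_of_orderOf_eq {G : Type*} [Group G] [Finite G] {a b : G}
    (h : orderOf a = orderOf b) (hab : a ∈ Subgroup.zpowers b) : b ∈ Subgroup.zpowers a := by
  have : Subgroup.zpowers a = Subgroup.zpowers b :=
    Subgroup.eq_of_le_of_card_ge (by rwa [Subgroup.zpowers_le])
      (by rw [Nat.card_zpowers, Nat.card_zpowers, h])
  rw [this]
  exact Subgroup.mem_zpowers b

theorem closure_pair_mul_right {G : Type*} [Group G] (a b : G) :
    Subgroup.closure ({a, a * b} : Set G) = Subgroup.closure ({a, b} : Set G) := by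
  have h1 := mem_closure_pair_left a b
  have h2 := mem_closure_pair_right a b
  have h3 := mem_closure_pair_left a (a * b)
  have h4 := mem_closure_pair_right a (a * b)
  apply le_antisymm
  · rw [Subgroup.closure_le, Set.insert_subset_iff, Set.singleton_subset_iff]
    exact ⟨h1, mul_mem h1 h2⟩
  · rw [Subgroup.closure_le, Set.insert_subset_iff, Set.singleton_subset_iff]
    exact ⟨h3, by simpa using mul_mem (inv_mem h3) h4⟩

/-- If the bound failed, `b` and `a * b` would both have the order of `a` and, by
`hasSmallRigidSet_of_sq_ne`, the square of `a`. Then `b` inverts `a` and centralises `a ^ 2 = b ^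
2`, so `a ^ 4 = 1` and `⟨a, b⟩` has order at most 8 after all. -/
theorem card_closure_pair_le_ten {G : Type*} [Group G] [Finite G] (hG : ¬ HasSmallRigidSet G)
    {a b : G} (ha : 4 ≤ orderOf a) (hb : b ∉ Subgroup.zpowers a)
    (hab : orderOf b = orderOf a) : Nat.card (Subgroup.closure ({a, b} : Set G)) ≤ 10 := by
  by_contra! hc
  have hne : ∀ n, 0 < n → n < 4 → a ^ n ≠ 1 := fun n h0 h9 =>
    pow_ne_one_of_lt_orderOf h0.ne' (by omega)
  have hsq : ∀ c, c ∉ Subgroup.zpowers a → orderOf c = orderOf a →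
      11 ≤ Nat.card (Subgroup.closure ({a, c} : Set G)) → a ^ 2 = c ^ 2 := by
    intro c hc ho hcard
    by_contra hn
    exact hG (hasSmallRigidSet_of_sq_ne (hne 3 (by norm_num) (by norm_num))
      (hne 2 (by norm_num) (by norm_num))
      (fun h => hc (mem_zpowers_comm_of_orderOf_eq ho.symm h)) hc hn hcard)
  have hab' : a * b ∉ Subgroup.zpowers a := fun h => hb (by
    simpa using mul_mem (inv_mem (Subgroup.mem_zpowers a)) h)
  have hc' : 11 ≤ Nat.card (Subgroup.closure ({a, a * b} : Set G)) := by
    rwa [closure_pair_mul_right]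
  have ho : orderOf (a * b) = orderOf a := by
    by_contra hn
    exact hG (hasSmallRigidSet_of_orderOf_ne
      (by simpa using hne 1 (by norm_num) (by norm_num))
      (by rintro h; exact hab' (by rw [h]; exact one_mem _)) (Ne.symm hn) (by omega))
  have h1 := hsq b hb hab hc
  have h2 := hsq _ hab' ho hc'
  have h3 : b * a * b = a := by
    rw [pow_two, pow_two, mul_assoc a b, mul_right_inj, ← mul_assoc] at h2
    exact h2.symm
  have h4 : b * a * b⁻¹ = a⁻¹ := by
    calc b * a * b⁻¹ = b * a * b * (b ^ 2)⁻¹ := by group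
      _ = a⁻¹ := by rw [h3, ← h1]; group
  have h5 : a ^ 4 = 1 := by
    have h6 : b * a ^ 2 * b⁻¹ = a ^ 2 := by rw [h1]; group
    rw [← conj_pow, h4, inv_pow, inv_eq_iff_mul_eq_one, ← pow_add] at h6
    exact h6
  have h6 := card_closure_pair_le (a := a) (b := b)
    (h4 ▸ inv_mem (Subgroup.mem_zpowers a)) (h1 ▸ Subgroup.npow_mem_zpowers _ _)
  have h7 := orderOf_le_of_pow_eq_one (by norm_num) h5
  omega

/-- The bound 10 forces `⟨a⟩` to have index 2 and `a` to have order 4 or 5. In the case of order 5,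
`b` also has order 5, so `b = (b ^ 2) ^ 3` lies in `⟨a⟩`. -/
theorem orderOf_eq_four_and_card_closure_pair {G : Type*} [Group G] [Finite G]
    (hG : ¬ HasSmallRigidSet G) {a b : G} (ha : 4 ≤ orderOf a) (hb : b ∉ Subgroup.zpowers a) :
    orderOf a = 4 ∧ Nat.card (Subgroup.closure ({a, b} : Set G)) = 8 := by
  obtain ⟨k, hk, hcard⟩ := Subgroup.exists_card_eq_mul (zpowers_lt_closure_pair hb)
  rw [Nat.card_zpowers] at hcard
  have h8 : orderOf b ≠ orderOf a → Nat.card (Subgroup.closure ({a, b} : Set G)) ≤ 8 := by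
    intro h
    by_contra! hc
    refine hG (hasSmallRigidSet_of_orderOf_ne ?_ ?_ h.symm hc)
    · rintro rfl
      simp at ha
    · rintro rfl
      exact hb (one_mem _)
  have h10 : Nat.card (Subgroup.closure ({a, b} : Set G)) ≤ 10 := by
    by_cases h : orderOf b = orderOf a
    · exact card_closure_pair_le_ten hG ha hb h
    · exact (h8 h).trans (by norm_num)
  have hk2 : k = 2 := by
    by_contra hn
    have : 3 ≤ k := by omega
    nlinarith
  subst hk2
  have h5 : orderOf a ≠ 5 := by
    intro h5
    have ho : orderOf b = orderOf a := by
      by_contra hn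
      have := h8 hn
      omega
    have hs := (Subgroup.sq_mem_and_conj_mem_of_card_eq (zpowers_lt_closure_pair hb).le
      (by rw [hcard, Nat.card_zpowers, mul_comm]) (mem_closure_pair_right a b)).1
    refine hb ?_
    have hb5 : b ^ 5 = 1 := by rw [← h5, ← ho]; exact pow_orderOf_eq_one b
    have : b = (b ^ 2) ^ 3 := by
      rw [← pow_mul, pow_succ, hb5, one_mul]
    rw [this]
    exact pow_mem hs 3
  omega

/-! ### Explicit sets in three-generator groups -/

theorem Commute.mul_right_iff_of_left {G : Type*} [Group G] {x c u : G} (h : Commute x c) :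
    Commute x (c * u) ↔ Commute x u :=
  ⟨fun h' => by simpa using h.inv_right.mul_right h', fun h' => h.mul_right h'⟩

theorem Commute.mul_right_iff_of_right {G : Type*} [Group G] {x c u : G} (h : Commute x c) :
    Commute x (u * c) ↔ Commute x u :=
  ⟨fun h' => by simpa using h'.mul_right h.inv_right, fun h' => h'.mul_right h⟩

section Central

variable {G : Type*} [Group G] [Finite G] {c x y z : G}

/-- In `{c, x, y, c * x}` only `c` commutes with every element, so it is fixed. Then `x` is the only
element other than `c` whose product with `c` stays in the set; here `c * c ≠ 1` stops `c * x` from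
returning to `x`. -/
theorem hasSmallRigidSet_of_central_sq_ne_one (hxc : Commute x c) (hyc : Commute y c)
    (hxy : ¬ Commute x y) (hc : c * c = z) (hz : z ≠ 1) (hcz : z ≠ c)
    (hcard : 13 ≤ Nat.card (Subgroup.closure ({x, y, c} : Set G))) : HasSmallRigidSet G := by
  classical
  have hyx : ¬ Commute y x := fun h => hxy h.symm
  have hxx := Commute.refl x
  have hyy := Commute.refl y
  have hxz : Commute x z := hc ▸ hxc.mul_right hxc
  have hyz : Commute y z := hc ▸ hyc.mul_right hyc
  have hx1 : x ≠ 1 := fun h => hxy (h ▸ Commute.one_left y)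
  have hc1 : c ≠ 1 := fun h => hz (by rw [← hc, h, one_mul])
  have hcx : c ≠ x := fun h => hxy (h ▸ hyc).symm
  have hcy : c ≠ y := fun h => hxy (h ▸ hxc)
  have hxny : x ≠ y := fun h => hxy (h ▸ hxx)
  have hy1 : y ≠ 1 := fun h => hxy (h ▸ Commute.one_right x)
  have hxcx : x ≠ c * x := fun h => hc1 (right_eq_mul.1 h)
  have hycx : y ≠ c * x := fun h => hxy (by rw [h]; exact hxc.mul_right hxx)
  have h4 : ({c, x, y, c * x} : Finset G).card = 4 := by
    rw [Finset.card_insert_of_notMem, Finset.card_insert_of_notMem, Finset.card_insert_of_notMem,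
      Finset.card_singleton] <;> simp [*]
  set K := Subgroup.closure ({x, y, c} : Set G) with hK
  have hxK : x ∈ K := Subgroup.subset_closure (by simp)
  have hyK : y ∈ K := Subgroup.subset_closure (by simp)
  have hcK : c ∈ K := Subgroup.subset_closure (by simp)
  have hcxK : c * x ∈ K := mul_mem hcK hxK
  refine hasSmallRigidSet_of_closure {c, x, y, c * x} (by omega) K ?_ ?_ (by omega) ?_
  · simp only [Finset.coe_insert, Finset.coe_singleton, Set.insert_subset_iff,
      Set.singleton_subset_iff, SetLike.mem_coe]
    exact ⟨hcK, hxK, hyK, hcxK⟩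
  · apply Subgroup.closure_mono
    simp [Set.insert_subset_iff]
  · intro f hmul hinj hf hsurj
    have hcomm : ∀ u ∈ ({c, x, y, c * x} : Finset G), Commute (f c) u := by
      intro u hu
      obtain ⟨v, hv, rfl⟩ := hsurj u hu
      have hv' : c * v = v * c ∧ v ∈ K := by
        simp only [Finset.mem_insert, Finset.mem_singleton] at hv
        rcases hv with rfl | rfl | rfl | rfl
        exacts [⟨rfl, hcK⟩, ⟨hxc.symm.eq, hxK⟩, ⟨hyc.symm.eq, hyK⟩,
          ⟨((Commute.refl c).mul_right hxc.symm).eq, hcxK⟩]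
      change f c * f v = f v * f c
      rw [← hmul _ hcK _ hv'.2, ← hmul _ hv'.2 _ hcK, hv'.1]
    have hfc : f c = c := by
      have h := hf c (by simp)
      have hx' := (hcomm x (by simp)).symm
      have hy' := (hcomm y (by simp)).symm
      simp only [Finset.mem_insert, Finset.mem_singleton] at h
      rcases h with h | h | h | h
      · exact h
      · exact absurd (h ▸ hy') hyx
      · exact absurd (h ▸ hx') hxy
      · rw [h, hyc.mul_right_iff_of_left] at hy'
        exact absurd hy' hyx
    have hfx : f x = x := by
      have h1 := hf x (by simp)
      have h2 := hf (c * x) (by simp)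
      rw [hmul _ hcK _ hxK, hfc] at h2
      have h3 : f x ≠ c := fun h => hcx (hinj _ hcK _ hxK (hfc.trans h.symm))
      simp only [Finset.mem_insert, Finset.mem_singleton] at h1 h2
      rcases h1 with h1 | h1 | h1 | h1
      · exact absurd h1 h3
      · exact h1
      · rw [h1] at h2
        rcases h2 with h2 | h2 | h2 | h2
        · exact absurd (mul_eq_left.1 h2) hy1
        · refine absurd ?_ hyx
          rw [← h2]
          exact hyc.mul_right hyy
        · exact absurd (mul_eq_right.1 h2) hc1
        · exact absurd (mul_left_cancel h2).symm hxny
      · rw [h1] at h2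
        have hq : ¬ Commute y (c * x) := by rwa [hyc.mul_right_iff_of_left]
        rcases h2 with h2 | h2 | h2 | h2
        · refine absurd ?_ hq
          rw [mul_eq_left.1 h2]
          exact Commute.one_right y
        · rw [← mul_assoc, hc, mul_eq_right] at h2
          exact absurd h2 hz
        · refine absurd ?_ hxy
          rw [← h2]
          exact hxc.mul_right (hxc.mul_right hxx)
        · exact absurd (mul_left_cancel h2) hxcx.symm
    have hfcx : f (c * x) = c * x := by rw [hmul _ hcK _ hxK, hfc, hfx]
    have hfy : f y = y := by
      have h := hf y (by simp)
      simp only [Finset.mem_insert, Finset.mem_singleton] at h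
      rcases h with h | h | h | h
      · exact absurd (hinj _ hcK _ hyK (hfc.trans h.symm)) hcy
      · exact absurd (hinj _ hxK _ hyK (hfx.trans h.symm)) hxny
      · exact h
      · exact absurd (hinj _ hyK _ hcxK (h.trans hfcx.symm)) hycx
    simp only [Finset.mem_insert, Finset.mem_singleton]
    rintro u (rfl | rfl | rfl | rfl)
    exacts [hfc, hfx, hfy, hfcx]

/-- For an involution `c`, multiplication by `c` can exchange `x` and `c * x`, so a fifth element is
needed: the set is `{c, x, c * x, y, x * y}`. Commutation fixes `c`, which leaves `{x, c * x}` and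
hence `{y, x * y}` invariant. The bound 13 is `2 * 5 + 3`. -/
theorem hasSmallRigidSet_of_central_sq_eq_one (hxc : Commute x c) (hyc : Commute y c)
    (hxy : ¬ Commute x y) (hc : c * c = 1) (hc1 : c ≠ 1) (hx : x * x = z) (hz : z ≠ 1)
    (hzy : Commute z y) (hcz : c * z ≠ 1)
    (hcard : 13 ≤ Nat.card (Subgroup.closure ({x, y, c} : Set G))) : HasSmallRigidSet G := by
  classical
  have hyx : ¬ Commute y x := fun h => hxy h.symm
  have hxx := Commute.refl x
  have hyy := Commute.refl y
  have hxz : Commute x z := hx ▸ hxx.mul_right hxx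
  have hyz : Commute y z := hzy.symm
  have hx1 : x ≠ 1 := fun h => hxy (h ▸ Commute.one_left y)
  have hy1 : y ≠ 1 := fun h => hxy (h ▸ Commute.one_right x)
  have hcx : c ≠ x := fun h => hxy (h ▸ hyc).symm
  have hcy : c ≠ y := fun h => hxy (h ▸ hxc)
  have hxny : x ≠ y := fun h => hxy (h ▸ hxx)
  have hycx : c * x ≠ y := fun h => hxy (by rw [← h]; exact hxc.mul_right hxx)
  have hcxy : c ≠ x * y := fun h => hyx (by
    rw [← hyy.mul_right_iff_of_right, ← h]; exact hyc)
  have hcxxy : c * x ≠ x * y := fun h => hxy (by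
    rw [← hxx.mul_right_iff_of_left, ← h]; exact hxc.mul_right hxx)
  have hpxy : ¬ Commute x (x * y) := by rwa [hxx.mul_right_iff_of_left]
  have hpcxy : ¬ Commute x (c * (x * y)) := by rwa [hxc.mul_right_iff_of_left]
  have hqcxy : ¬ Commute y (c * (x * y)) := by
    rwa [hyc.mul_right_iff_of_left, hyy.mul_right_iff_of_right]
  have hpxcx : Commute x (c * x) := hxc.mul_right hxx
  have h5 : ({c, x, c * x, y, x * y} : Finset G).card = 5 := by
    rw [Finset.card_insert_of_notMem, Finset.card_insert_of_notMem, Finset.card_insert_of_notMem,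
      Finset.card_insert_of_notMem, Finset.card_singleton] <;> simp [*]
  set K := Subgroup.closure ({x, y, c} : Set G) with hK
  have hxK : x ∈ K := Subgroup.subset_closure (by simp)
  have hyK : y ∈ K := Subgroup.subset_closure (by simp)
  have hcK : c ∈ K := Subgroup.subset_closure (by simp)
  have hcxK : c * x ∈ K := mul_mem hcK hxK
  have hxyK : x * y ∈ K := mul_mem hxK hyK
  refine hasSmallRigidSet_of_closure {c, x, c * x, y, x * y} (by omega) K ?_ ?_ (by omega) ?_
  · simp only [Finset.coe_insert, Finset.coe_singleton, Set.insert_subset_iff,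
      Set.singleton_subset_iff, SetLike.mem_coe]
    exact ⟨hcK, hxK, hcxK, hyK, hxyK⟩
  · apply Subgroup.closure_mono
    simp [Set.insert_subset_iff]
  · intro f hmul hinj hf hsurj
    have hcomm : ∀ u ∈ ({c, x, c * x, y, x * y} : Finset G), Commute (f c) u := by
      intro u hu
      obtain ⟨v, hv, rfl⟩ := hsurj u hu
      have hv' : c * v = v * c ∧ v ∈ K := by
        simp only [Finset.mem_insert, Finset.mem_singleton] at hv
        rcases hv with rfl | rfl | rfl | rfl | rfl
        exacts [⟨rfl, hcK⟩, ⟨hxc.symm.eq, hxK⟩, ⟨((Commute.refl c).mul_right hxc.symm).eq, hcxK⟩,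
          ⟨hyc.symm.eq, hyK⟩, ⟨(hxc.symm.mul_right hyc.symm).eq, hxyK⟩]
      change f c * f v = f v * f c
      rw [← hmul _ hcK _ hv'.2, ← hmul _ hv'.2 _ hcK, hv'.1]
    have hfc : f c = c := by
      have h := hf c (by simp)
      have hx' := (hcomm x (by simp)).symm
      have hy' := (hcomm y (by simp)).symm
      simp only [Finset.mem_insert, Finset.mem_singleton] at h
      rcases h with h | h | h | h | h
      · exact h
      · exact absurd (h ▸ hy') hyx
      · rw [h, hyc.mul_right_iff_of_left] at hy'
        exact absurd hy' hyx
      · exact absurd (h ▸ hx') hxy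
      · rw [h, hxx.mul_right_iff_of_left] at hx'
        exact absurd hx' hxy
    have hfx : f x = x ∨ f x = c * x := by
      have h1 := hf x (by simp)
      have h2 := hf (c * x) (by simp)
      rw [hmul _ hcK _ hxK, hfc] at h2
      have h3 : f x ≠ c := fun h => hcx (hinj _ hcK _ hxK (hfc.trans h.symm))
      simp only [Finset.mem_insert, Finset.mem_singleton] at h1 h2
      rcases h1 with h1 | h1 | h1 | h1 | h1
      · exact absurd h1 h3
      · exact Or.inl h1
      · exact Or.inr h1
      · rw [h1] at h2
        rcases h2 with h2 | h2 | h2 | h2 | h2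
        · exact absurd (mul_eq_left.1 h2) hy1
        · refine absurd ?_ hyx
          rw [← h2]
          exact hyc.mul_right hyy
        · exact absurd (mul_left_cancel h2).symm hxny
        · exact absurd (mul_eq_right.1 h2) hc1
        · exact absurd (mul_right_cancel h2) hcx
      · rw [h1] at h2
        rcases h2 with h2 | h2 | h2 | h2 | h2
        · refine absurd ?_ hpxy
          rw [mul_eq_left.1 h2]
          exact Commute.one_right x
        · refine absurd ?_ hpcxy
          rw [h2]
        · exact absurd (mul_eq_left.1 (mul_left_cancel h2)) hy1
        · refine absurd ?_ hqcxy
          rw [h2]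
        · exact absurd (mul_eq_right.1 h2) hc1
    have hfcx : f (c * x) = c * f x := by rw [hmul _ hcK _ hxK, hfc]
    have hfy : f y = y ∨ f y = x * y := by
      have h := hf y (by simp)
      simp only [Finset.mem_insert, Finset.mem_singleton] at h
      rcases h with h | h | h | h | h
      · exact absurd (hinj _ hcK _ hyK (hfc.trans h.symm)) hcy
      · rcases hfx with h' | h'
        · exact absurd (hinj _ hxK _ hyK (h'.trans h.symm)) hxny
        · rw [h', ← mul_assoc, hc, one_mul] at hfcx
          exact absurd (hinj _ hcxK _ hyK (hfcx.trans h.symm)) hycx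
      · rcases hfx with h' | h'
        · rw [h'] at hfcx
          exact absurd (hinj _ hcxK _ hyK (hfcx.trans h.symm)) hycx
        · exact absurd (hinj _ hxK _ hyK (h'.trans h.symm)) hxny
      · exact Or.inl h
      · exact Or.inr h
    have hfxy := hf (x * y) (by simp)
    rw [hmul _ hxK _ hyK] at hfxy
    -- The product `f x * f y` must lie in the set. Of the three unwanted combinations, `x * (x * y)
    -- = z * y` is excluded by `z ≠ 1`, `c * x * y` by `c ≠ 1`, and `c * x * (x * y) = c * z * y` by
    -- `c * z ≠ 1`.
    have hboth : f x = x ∧ f y = y := by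
      simp only [Finset.mem_insert, Finset.mem_singleton] at hfxy
      rcases hfx with h1 | h1 <;> rcases hfy with h2 | h2
      · exact ⟨h1, h2⟩
      · rw [h1, h2] at hfxy
        have hp : ¬ Commute x (x * (x * y)) := by rwa [hxx.mul_right_iff_of_left]
        rcases hfxy with h3 | h3 | h3 | h3 | h3
        · exact absurd (h3 ▸ hxc) hp
        · exact absurd (by rw [h3]) hp
        · exact absurd (by rwa [h3]) hp
        · rw [← mul_assoc, hx, mul_eq_right] at h3
          exact absurd h3 hz
        · exact absurd (mul_eq_right.1 (mul_left_cancel h3)) hx1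
      · rw [h1, h2, mul_assoc] at hfxy
        rcases hfxy with h3 | h3 | h3 | h3 | h3
        · exact absurd (by rwa [h3]) hpcxy
        · exact absurd (by rw [h3]) hpcxy
        · exact absurd (by rwa [h3]) hpcxy
        · exact absurd (by rw [h3]) hqcxy
        · exact absurd (mul_eq_right.1 h3) hc1
      · rw [h1, h2] at hfxy
        have hp : ¬ Commute x (c * x * (x * y)) := by rwa [hpxcx.mul_right_iff_of_left]
        rcases hfxy with h3 | h3 | h3 | h3 | h3
        · exact absurd (by rwa [h3]) hp
        · exact absurd (by rw [h3]) hp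
        · exact absurd (by rwa [h3]) hp
        · rw [← mul_assoc, mul_eq_right, mul_assoc, hx] at h3
          exact absurd h3 hcz
        · exact absurd (eq_inv_of_mul_eq_one_left (mul_eq_right.1 h3) ▸ hyc) (by simpa using hyx)
    simp only [Finset.mem_insert, Finset.mem_singleton]
    rintro u (rfl | rfl | rfl | rfl | rfl)
    exacts [hfc, hboth.1, by rw [hfcx, hboth.1], hboth.2, by
      rw [hmul _ hxK _ hyK, hboth.1, hboth.2]]

end Central

/-- The set is `{a, a * b, a * b * c, b, c * z}`. The element `z` is fixed as the only nontrivial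
square, so squares separate the first three elements from the last two. With `c` in place of `c * z`
the set would be preserved by exchanging `a` with `a * b * c` and `b` with `c`; the factor `z`
breaks this symmetry. -/
theorem hasSmallRigidSet_of_commGroup {G : Type*} [CommGroup G] [Finite G] {a b c z : G}
    (hsq : ∀ v : G, v * v = 1 ∨ v * v = z) (hz : z ≠ 1) (ha : a * a = z) (hb : b * b = 1)
    (hc : c * c = 1) (hbz : b ∉ Subgroup.zpowers a)
    (hcab : c ∉ Subgroup.closure ({a, b} : Set G))
    (hcard : 13 ≤ Nat.card (Subgroup.closure ({a, b, c} : Set G))) : HasSmallRigidSet G := by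
  classical
  set L := Subgroup.closure ({a, b} : Set G) with hL
  have haL : a ∈ L := mem_closure_pair_left a b
  have hbL : b ∈ L := mem_closure_pair_right a b
  have hzL : z ∈ L := ha ▸ mul_mem haL haL
  have hzz : z * z = 1 := by
    rcases hsq z with h | h
    · exact h
    · exact absurd (by simpa using h) hz
  have haz : a ∈ Subgroup.zpowers a := Subgroup.mem_zpowers a
  have hzz' : z ∈ Subgroup.zpowers a := ha ▸ mul_mem haz haz
  have hne : ∀ u ∈ L, c ≠ u := fun u hu h => hcab (h ▸ hu)
  have hne' : ∀ u ∈ Subgroup.zpowers a, b ≠ u := fun u hu h => hbz (h ▸ hu)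
  have hb1 := hne' 1 (one_mem _)
  have hbz1 := hne' z hzz'
  have hba := hne' a haz
  have hc1 := hne 1 (one_mem _)
  have hcb := hne b hbL
  have hca := hne a haL
  have hcz := hne z hzL
  have hczb : c * z ≠ b := fun h => hne _ (mul_mem hbL (inv_mem hzL)) (by rw [← h]; simp)
  have hcz1 : c * z ≠ 1 := fun h => hne _ (inv_mem hzL)
    (eq_inv_of_mul_eq_one_left h)
  have hbcz : b * (c * z) ≠ 1 := fun h => hczb (by
    rw [← mul_right_inj b, h, hb])
  have hbz' : b * z ≠ 1 := fun h => hbz1 (by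
    rw [eq_inv_of_mul_eq_one_left h, inv_eq_of_mul_eq_one_left hzz])
  have ha1 : a ≠ 1 := fun h => hz (by rw [← ha, h, one_mul])
  have sqne : ∀ {u v : G}, u * u = 1 → v * v = z → u ≠ v := fun hu hv h => hz (by
    rw [← hv, ← h, hu])
  have hab2 : (a * b) * (a * b) = z := by rw [mul_mul_mul_comm, ha, hb, mul_one]
  have habc2 : (a * b * c) * (a * b * c) = z := by rw [mul_mul_mul_comm, hab2, hc, mul_one]
  have hcz2 : (c * z) * (c * z) = 1 := by rw [mul_mul_mul_comm, hc, hzz, mul_one]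
  have h5 : ({a, a * b, a * b * c, b, c * z} : Finset G).card = 5 := by
    rw [Finset.card_insert_of_notMem, Finset.card_insert_of_notMem, Finset.card_insert_of_notMem,
      Finset.card_insert_of_notMem, Finset.card_singleton]
    · simpa using hczb.symm
    · simpa using ⟨(sqne hb habc2).symm, (sqne hcz2 habc2).symm⟩
    · simpa using ⟨hc1, ha1, (sqne hcz2 hab2).symm⟩
    · have : a ≠ a * b * c := fun h => hne _ (inv_mem hbL) (by
        rw [mul_assoc, left_eq_mul] at h
        exact eq_inv_of_mul_eq_one_right h)
      simpa using ⟨hb1, this, hba.symm, (sqne hcz2 ha).symm⟩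
  set K := Subgroup.closure ({a, b, c} : Set G) with hK
  have haK : a ∈ K := Subgroup.subset_closure (by simp)
  have hbK : b ∈ K := Subgroup.subset_closure (by simp)
  have hcK : c ∈ K := Subgroup.subset_closure (by simp)
  have hzK : z ∈ K := ha ▸ mul_mem haK haK
  have hczK : c * z ∈ K := mul_mem hcK hzK
  have habK : a * b ∈ K := mul_mem haK hbK
  have habcK : a * b * c ∈ K := mul_mem habK hcK
  refine hasSmallRigidSet_of_closure {a, a * b, a * b * c, b, c * z} (by omega) K ?_ ?_
    (by omega) ?_
  · simp only [Finset.coe_insert, Finset.coe_singleton, Set.insert_subset_iff,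
      Set.singleton_subset_iff, SetLike.mem_coe]
    exact ⟨haK, habK, habcK, hbK, hczK⟩
  · set T := Subgroup.closure ((({a, a * b, a * b * c, b, c * z} : Finset G)) : Set G)
    have h1 : a ∈ T := Subgroup.subset_closure (by simp)
    have h2 : b ∈ T := Subgroup.subset_closure (by simp)
    have h3 : a * b * c ∈ T := Subgroup.subset_closure (by simp)
    rw [Subgroup.closure_le, Set.insert_subset_iff, Set.insert_subset_iff,
      Set.singleton_subset_iff]
    exact ⟨h1, h2, (mul_mem_cancel_left (mul_mem h1 h2)).1 h3⟩
  · intro f hmul hinj hf hsurj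
    have hfz : f z = z := by
      have h1 : f z ≠ 1 := partialHom_ne_one hmul hinj hzK hz
      rw [← ha, hmul _ haK _ haK] at h1 ⊢
      rw [ha]
      exact (hsq _).resolve_left h1
    have hfsq : ∀ u ∈ K, ∀ w ∈ K, u * u = w → f w = w → f u * f u = w := by
      intro u hu w hw huw hfw
      rw [← hmul _ hu _ hu, huw, hfw]
    have hf1 := partialHom_one hmul
    have hfa : f a = a ∨ f a = a * b ∨ f a = a * b * c := by
      have h := hf a (by simp)
      have h2 := hfsq a haK z hzK ha hfz
      simp only [Finset.mem_insert, Finset.mem_singleton] at h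
      rcases h with h | h | h | h | h
      · exact Or.inl h
      · exact Or.inr (Or.inl h)
      · exact Or.inr (Or.inr h)
      · exact absurd h.symm (sqne hb h2)
      · exact absurd h.symm (sqne hcz2 h2)
    have hfinv : ∀ u ∈ K, u * u = 1 → u ∈ ({a, a * b, a * b * c, b, c * z} : Finset G) →
        f u = b ∨ f u = c * z := by
      intro u huK hu huY
      have h := hf u huY
      have h2 := hfsq u huK 1 (one_mem _) hu hf1
      simp only [Finset.mem_insert, Finset.mem_singleton] at h
      rcases h with h | h | h | h | h
      · exact absurd h (sqne h2 ha)
      · exact absurd h (sqne h2 hab2)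
      · exact absurd h (sqne h2 habc2)
      · exact Or.inl h
      · exact Or.inr h
    have hfb := hfinv b hbK hb (by simp)
    have hfcz := hfinv (c * z) hczK hcz2 (by simp)
    have hord : ∀ u ∈ K, u * u = z → u ∈ ({a, a * b, a * b * c, b, c * z} : Finset G) →
        f u = a ∨ f u = a * b ∨ f u = a * b * c := by
      intro u huK hu huY
      have h := hf u huY
      have h2 := hfsq u huK z hzK hu hfz
      simp only [Finset.mem_insert, Finset.mem_singleton] at h
      rcases h with h | h | h | h | h
      · exact Or.inl h
      · exact Or.inr (Or.inl h)
      · exact Or.inr (Or.inr h)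
      · exact absurd h.symm (sqne hb h2)
      · exact absurd h.symm (sqne hcz2 h2)
    have hfab := hord (a * b) habK hab2 (by simp)
    have hfabc := hord (a * b * c) habcK habc2 (by simp)
    have hac : ¬ (a * c = a ∨ a * c = a * b ∨ a * c = a * b * c) := by
      rintro (h | h | h)
      · exact hc1 (mul_eq_left.1 h)
      · exact hcb (mul_left_cancel h)
      · exact hb1 (left_eq_mul.1 (mul_right_cancel h))
    have hczb' : f (c * z) ≠ f b := fun h => hczb (hinj _ hczK _ hbK h)
    rw [hmul _ haK _ hbK] at hfab
    -- If `b` is fixed, so is `c`, and moving `a` would put `a * c` among the first three elements.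
    -- If `b` goes to `c * z`, then `c * z` is a ratio of two of the first three elements; but these
    -- ratios are `1`, `b`, `c` and `b * c`.
    have hfall : f a = a ∧ f b = b ∧ f c = c := by
      rw [hmul _ habK _ hcK, hmul _ haK _ hbK] at hfabc
      rcases hfb with hfb | hfb
      · have hfc : f c = c := by
          have h := hfcz.resolve_left (by rwa [hfb] at hczb')
          rwa [hmul _ hcK _ hzK, hfz, mul_left_inj] at h
        rw [hfb, hfc] at hfabc
        refine ⟨?_, hfb, hfc⟩
        rcases hfa with hfa | hfa | hfa
        · exact hfa
        · rw [hfa, mul_assoc a b b, hb, mul_one] at hfabc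
          exact absurd hfabc hac
        · rw [hfa, hfb, mul_right_comm, mul_assoc a b b, hb, mul_one] at hfab
          exact absurd hfab hac
      · exfalso
        rw [hfb] at hfab
        rcases hfa with hfa | hfa | hfa <;> rw [hfa] at hfab
        · rcases hfab with h | h | h
          · exact hcz1 (mul_eq_left.1 h)
          · exact hczb (mul_left_cancel h)
          · rw [mul_assoc, mul_comm c z] at h
            exact hbz1 (mul_right_cancel (mul_left_cancel h)).symm
        · rcases hfab with h | h | h
          · rw [mul_assoc, mul_eq_left] at h
            exact hbcz h
          · exact hcz1 (mul_eq_left.1 h)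
          · exact hz (mul_eq_left.1 (mul_left_cancel h))
        · rw [mul_assoc, ← mul_assoc c c z, hc, one_mul] at hfab
          rcases hfab with h | h | h
          · rw [mul_assoc, mul_eq_left] at h
            exact hbz' h
          · exact hz (mul_eq_left.1 h)
          · exact hcz (mul_left_cancel h).symm
    obtain ⟨h1, h2, h3⟩ := hfall
    simp only [Finset.mem_insert, Finset.mem_singleton]
    rintro u (rfl | rfl | rfl | rfl | rfl)
    · exact h1
    · rw [hmul _ haK _ hbK, h1, h2]
    · rw [hmul _ habK _ hcK, hmul _ haK _ hbK, h1, h2, h3]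
    · exact h2
    · rw [hmul _ hcK _ hzK, h3, hfz]

/-! ### Groups of maximal element order four without small rigid sets -/

theorem mem_zpowers_of_orderOf_eq_four {G : Type*} [Group G] [Finite G] {a w : G}
    (ha : orderOf a = 4) (hw : w ∈ Subgroup.zpowers a) :
    w = 1 ∨ w = a ∨ w = a ^ 2 ∨ w = a ^ 3 := by
  classical
  rw [mem_zpowers_iff_mem_range_orderOf, ha] at hw
  simp only [Finset.mem_image, Finset.mem_range] at hw
  obtain ⟨k, hk, rfl⟩ := hw
  interval_cases k <;> simp

theorem sq_mem_and_conj_mem_of_orderOf_eq_four {G : Type*} [Group G] [Finite G]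
    (hG : ¬ HasSmallRigidSet G) {a : G} (ha : orderOf a = 4) (v : G) :
    v ^ 2 ∈ Subgroup.zpowers a ∧ v * a * v⁻¹ ∈ Subgroup.zpowers a := by
  have haa := Subgroup.mem_zpowers a
  by_cases hv : v ∈ Subgroup.zpowers a
  · exact ⟨pow_mem hv 2, mul_mem (mul_mem hv haa) (inv_mem hv)⟩
  · have h8 := (orderOf_eq_four_and_card_closure_pair hG ha.ge hv).2
    have h := Subgroup.sq_mem_and_conj_mem_of_card_eq (zpowers_lt_closure_pair hv).le
      (by rw [h8, Nat.card_zpowers, ha]) (mem_closure_pair_right a v)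
    exact ⟨h.1, h.2 a haa⟩

theorem sq_eq_one_or_sq_eq_sq {G : Type*} [Group G] [Finite G] (hG : ¬ HasSmallRigidSet G)
    (h4 : ∀ v : G, orderOf v ≤ 4) {a : G} (ha : orderOf a = 4) (v : G) :
    v * v = 1 ∨ v * v = a * a := by
  have hv := (sq_mem_and_conj_mem_of_orderOf_eq_four hG ha v).1
  have ha4 : a ^ 4 = 1 := ha ▸ pow_orderOf_eq_one a
  have ha2 : a ^ 2 ≠ 1 := pow_ne_one_of_lt_orderOf (by norm_num) (by omega)
  -- As `v ^ 2` lies in a group of order 4, the order of `v` is a power of two; being at most 4, it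
  -- divides 4, so `v ^ 2` has order at most 2.
  have hv8 : orderOf v ∣ 8 := by
    rw [orderOf_dvd_iff_pow_eq_one, show (8 : ℕ) = 2 * 4 from rfl, pow_mul]
    have := orderOf_dvd_of_mem_zpowers hv
    rw [ha, orderOf_dvd_iff_pow_eq_one] at this
    exact this
  have hv4 : v ^ 4 = 1 := by
    rw [← orderOf_dvd_iff_pow_eq_one]
    have h1 := h4 v
    interval_cases h : orderOf v <;> omega
  have hv2 : (v ^ 2) ^ 2 = 1 := by rw [← pow_mul]; exact hv4
  rw [← pow_two, ← pow_two]
  rcases mem_zpowers_of_orderOf_eq_four ha hv with h | h | h | h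
  · exact Or.inl h
  · rw [h] at hv2
    exact absurd hv2 ha2
  · exact Or.inr h
  · rw [h, ← pow_mul, show 3 * 2 = 4 + 2 from rfl, pow_add, ha4, one_mul] at hv2
    exact absurd hv2 ha2

/-- Conjugation by `v` preserves `⟨a⟩`, whose only involution is `a ^ 2`. -/
theorem commute_mul_self_of_orderOf_eq_four {G : Type*} [Group G] [Finite G]
    (hG : ¬ HasSmallRigidSet G) {a : G} (ha : orderOf a = 4) (v : G) : Commute v (a * a) := by
  have hv := (sq_mem_and_conj_mem_of_orderOf_eq_four hG ha v).2
  have ha4 : a ^ 4 = 1 := ha ▸ pow_orderOf_eq_one a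
  have ha2 : a ^ 2 ≠ 1 := pow_ne_one_of_lt_orderOf (by norm_num) (by omega)
  have hconj : (v * a * v⁻¹) ^ 2 = v * a ^ 2 * v⁻¹ := conj_pow
  have key : v * a ^ 2 * v⁻¹ = a ^ 2 := by
    have hne : v * a ^ 2 * v⁻¹ ≠ 1 := by
      simpa using ha2
    rw [← hconj] at hne ⊢
    rcases mem_zpowers_of_orderOf_eq_four ha hv with h | h | h | h <;> rw [h] at hne ⊢
    · simp at hne
    · rw [← pow_mul] at hne
      exact absurd ha4 hne
    · rw [← pow_mul, show 3 * 2 = 4 + 2 from rfl, pow_add, ha4, one_mul]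
  rw [mul_inv_eq_iff_eq_mul, pow_two] at key
  exact key

/-- If `z` is central of order dividing two and every square is `1` or `z`, then any two elements
commute up to a factor `z`. -/
theorem commute_or_mul_eq_mul_mul {G : Type*} [Group G] {z : G} (hzz : z * z = 1)
    (hzc : ∀ v : G, Commute v z) (hsq : ∀ v : G, v * v = 1 ∨ v * v = z) (x y : G) :
    Commute x y ∨ x * y = y * x * z := by
  have hinv : ∀ v : G, ∃ e : G, (e = 1 ∨ e = z) ∧ v⁻¹ = v * e := fun v => by
    rcases hsq v with h | h
    · exact ⟨1, Or.inl rfl, by rw [mul_one]; exact inv_eq_of_mul_eq_one_left h⟩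
    · exact ⟨z, Or.inr rfl, inv_eq_of_mul_eq_one_right (by rw [← mul_assoc, h, hzz])⟩
  have hc : ∀ e : G, (e = 1 ∨ e = z) → ∀ v, v * e = e * v := by
    rintro e (rfl | rfl) v
    · simp
    · exact hzc v
  have hmul : ∀ e e' : G, (e = 1 ∨ e = z) → (e' = 1 ∨ e' = z) → (e * e' = 1 ∨ e * e' = z) := by
    rintro e e' (rfl | rfl) (rfl | rfl) <;> simp [hzz]
  obtain ⟨e1, h1, hx⟩ := hinv x
  obtain ⟨e2, h2, hy⟩ := hinv y
  obtain ⟨e3, h3, hyx⟩ := hinv (y * x)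
  -- Modulo `{1, z}` every element is its own inverse; expanding `(y * x)⁻¹` in two ways compares `x
  -- * y` with `y * x`.
  have key : x * y * (e2 * e1) = y * x * e3 := by
    rw [← hyx, mul_inv_rev, hx, hy, mul_assoc, mul_assoc, ← mul_assoc y, hc e1 h1 (y * e2)]
  have hee := hmul _ _ h2 h1
  have hself : (e2 * e1) * (e2 * e1) = 1 := by
    rcases hee with h | h <;> simp [h, hzz]
  have key2 : x * y = y * x * (e3 * (e2 * e1)) := by
    rw [← mul_assoc, ← key, mul_assoc (x * y), hself, mul_one]
  rcases hmul _ _ h3 hee with h | h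
  · left
    rw [h, mul_one] at key2
    exact key2
  · right
    rwa [h] at key2

theorem closure_pair_lt_closure_triple {G : Type*} [Group G] {a b c : G}
    (hc : c ∉ Subgroup.closure ({a, b} : Set G)) :
    Subgroup.closure ({a, b} : Set G) < Subgroup.closure ({a, b, c} : Set G) := by
  refine lt_of_le_of_ne (Subgroup.closure_mono ?_) fun h => hc (h ▸ Subgroup.subset_closure (by simp))
  simp [Set.insert_subset_iff]

theorem exists_notMem_of_ne_top {G : Type*} [Group G] {K : Subgroup G} (h : K ≠ ⊤) :
    ∃ c, c ∉ K := by
  by_contra! hall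
  exact h ((Subgroup.eq_top_iff' K).2 hall)

/-- A group without small rigid sets, with an element of order four and none of larger order, is
generated by two elements, one of them of order four. -/
theorem exists_closure_pair_eq_top {G : Type*} [Group G] [Finite G] (hG : ¬ HasSmallRigidSet G)
    (h4 : ∀ v : G, orderOf v ≤ 4) (hex : ∃ a : G, orderOf a = 4) :
    ∃ a b : G, orderOf a = 4 ∧ Subgroup.closure ({a, b} : Set G) = ⊤ := by
  by_contra! hgen
  obtain ⟨a, ha⟩ := hex
  obtain ⟨z, hz⟩ : ∃ z, z = a * a := ⟨_, rfl⟩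
  have hsq : ∀ v : G, v * v = 1 ∨ v * v = z := fun v => hz ▸ sq_eq_one_or_sq_eq_sq hG h4 ha v
  have hzc : ∀ v : G, Commute v z := fun v => hz ▸ commute_mul_self_of_orderOf_eq_four hG ha v
  have hz1 : z ≠ 1 := by
    rw [hz, ← pow_two]
    exact pow_ne_one_of_lt_orderOf (by norm_num) (by omega)
  have hzz : z * z = 1 := by
    rcases hsq z with h | h
    · exact h
    · exact absurd (by simpa using h) hz1
  -- The pair generates a group of order 8, so a third generator gives order at least 16.
  have hcard : ∀ {x y c : G}, orderOf x = 4 → y ∉ Subgroup.zpowers x →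
      c ∉ Subgroup.closure ({x, y} : Set G) →
      13 ≤ Nat.card (Subgroup.closure ({x, y, c} : Set G)) := by
    intro x y c hx hy hc
    obtain ⟨k, hk, h⟩ := Subgroup.exists_card_eq_mul (closure_pair_lt_closure_triple hc)
    rw [(orderOf_eq_four_and_card_closure_pair hG hx.ge hy).2] at h
    omega
  have hord : ∀ {x : G}, x * x = z → orderOf x = 4 := by
    intro x hx
    rw [show (4 : ℕ) = 2 ^ (1 + 1) from rfl]
    apply orderOf_eq_prime_pow
    · rw [pow_one, pow_two, hx]
      exact hz1
    · rw [show 2 ^ (1 + 1) = 2 * 2 from rfl, pow_mul, pow_two x, hx, pow_two, hzz]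
  by_cases hcomm : ∀ x y : G, Commute x y
  · obtain ⟨b, hb, hb2⟩ : ∃ b, b ∉ Subgroup.zpowers a ∧ b * b = 1 := by
      obtain ⟨b, hb⟩ := exists_notMem_of_ne_top (K := Subgroup.zpowers a) fun h =>
        hgen a 1 ha (top_le_iff.1 (h ▸ by
          rw [Subgroup.zpowers_le]; exact mem_closure_pair_left a 1))
      rcases hsq b with h | h
      · exact ⟨b, hb, h⟩
      -- In the commutative case, multiplying an element of square `z` by `a` makes its square `z *
      -- z = 1`.
      · refine ⟨a * b, fun h' => hb ((mul_mem_cancel_left (Subgroup.mem_zpowers a)).1 h'), ?_⟩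
        rw [(hcomm b a).mul_mul_mul_comm, h, ← hz, hzz]
    obtain ⟨c, hc, hc2⟩ : ∃ c, c ∉ Subgroup.closure ({a, b} : Set G) ∧ c * c = 1 := by
      obtain ⟨c, hc⟩ := exists_notMem_of_ne_top (hgen a b ha)
      rcases hsq c with h | h
      · exact ⟨c, hc, h⟩
      · refine ⟨a * c, fun h' => hc ((mul_mem_cancel_left (mem_closure_pair_left a b)).1 h'), ?_⟩
        rw [(hcomm c a).mul_mul_mul_comm, h, ← hz, hzz]
    let _ : CommGroup G := { ‹Group G› with mul_comm := fun x y => (hcomm x y).eq }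
    exact hG (hasSmallRigidSet_of_commGroup hsq hz1 hz.symm hb2 hc2 hb hc (hcard ha hb hc))
  · push Not at hcomm
    -- If neither of two non-commuting elements has square `z`, both square to `1`; their product
    -- then cannot square to `1`, and replaces `x`.
    obtain ⟨x, y, hxy, hx2⟩ : ∃ x y : G, ¬ Commute x y ∧ x * x = z := by
      obtain ⟨x, y, hxy⟩ := hcomm
      rcases hsq x with hx | hx
      · rcases hsq y with hy | hy
        · have hnxy : ¬ Commute (x * y) y := fun h => hxy (by
            have := (Commute.mul_right_iff_of_right (u := x) (Commute.refl y)).1 h.symm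
            exact this.symm)
          refine ⟨x * y, y, hnxy, (hsq _).resolve_left fun h => hxy ?_⟩
          have h1 : x⁻¹ = x := inv_eq_of_mul_eq_one_left hx
          have h2 : y⁻¹ = y := inv_eq_of_mul_eq_one_left hy
          have h3 : (x * y)⁻¹ = x * y := inv_eq_of_mul_eq_one_left h
          rw [mul_inv_rev, h1, h2] at h3
          exact h3.symm
        · exact ⟨y, x, fun h => hxy h.symm, hy⟩
      · exact ⟨x, y, hxy, hx⟩
    have hx4 := hord hx2
    have hyx : y ∉ Subgroup.zpowers x := by
      rintro ⟨k, rfl⟩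
      exact hxy ((Commute.refl x).zpow_right k)
    have hdich := commute_or_mul_eq_mul_mul hzz hzc hsq
    -- Moving `x` past each of the two factors costs a `z`, and the two cancel. Thus an element
    -- outside `⟨x, y⟩` can be corrected by `y` and then by `x` until it commutes with both, without
    -- entering `⟨x, y⟩`.
    have hfixcomm : ∀ {x y c : G}, ¬ Commute x y → ¬ Commute x c → Commute x (c * y) := by
      intro x y c h1 h2
      have h3 := (hdich x y).resolve_left h1
      have h4 := (hdich x c).resolve_left h2
      change x * (c * y) = c * y * x
      calc x * (c * y) = c * x * z * y := by rw [← mul_assoc, h4]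
        _ = c * (x * y) * z := by
          rw [mul_assoc _ z y, (hzc y).symm.eq, mul_assoc, mul_assoc, mul_assoc]
        _ = c * y * x := by rw [h3, mul_assoc, mul_assoc, hzz, mul_one, mul_assoc]
    obtain ⟨c, hxc, hyc, hc⟩ : ∃ c, Commute x c ∧ Commute y c ∧
        c ∉ Subgroup.closure ({x, y} : Set G) := by
      obtain ⟨c, hc⟩ := exists_notMem_of_ne_top (hgen x y hx4)
      obtain ⟨d, hd, hxd⟩ : ∃ d, d ∉ Subgroup.closure ({x, y} : Set G) ∧ Commute x d := by
        by_cases h : Commute x c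
        · exact ⟨c, hc, h⟩
        · exact ⟨c * y, fun h' => hc ((mul_mem_cancel_right (mem_closure_pair_right x y)).1 h'),
            hfixcomm hxy h⟩
      by_cases h : Commute y d
      · exact ⟨d, hxd, h, hd⟩
      · exact ⟨d * x, hxd.mul_right (Commute.refl x), hfixcomm (fun h' => hxy h'.symm) h,
          fun h' => hd ((mul_mem_cancel_right (mem_closure_pair_left x y)).1 h')⟩
    have hzD : z ∈ Subgroup.closure ({x, y} : Set G) :=
      hx2 ▸ mul_mem (mem_closure_pair_left x y) (mem_closure_pair_left x y)
    have hc13 := hcard hx4 hyx hc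
    rcases hsq c with h | h
    · refine hG (hasSmallRigidSet_of_central_sq_eq_one hxc hyc hxy h ?_ hx2 hz1 (hzc y).symm ?_
        hc13)
      · rintro rfl
        exact hc (one_mem _)
      · intro h'
        exact hc ((mul_mem_cancel_right hzD).1 (h' ▸ one_mem _))
    · refine hG (hasSmallRigidSet_of_central_sq_ne_one hxc hyc hxy h hz1 ?_ hc13)
      rintro rfl
      exact hc hzD

/-! ### Rigid sets of arbitrary size; recognising the quaternion group -/

/-- A group is rigidified by a subset `Y` if no automorphism except the identity preserves `Y`. -/
def HasRigidSet (G : Type*) [Group G] : Prop :=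
  ∃ Y : Set G, ∀ σ : G ≃* G, Set.MapsTo σ Y Y → ∀ x, σ x = x

theorem HasSmallRigidSet.hasRigidSet {G : Type*} [Group G] (h : HasSmallRigidSet G) :
    HasRigidSet G :=
  let ⟨Y, _, _, hY⟩ := h
  ⟨Y, hY⟩

theorem MulEquiv.eq_self_of_closure_eq_top {G : Type*} [Group G] {s : Set G}
    (hs : Subgroup.closure s = ⊤) (σ : G ≃* G) (h : ∀ x ∈ s, σ x = x) (x : G) : σ x = x := by
  have hle : Subgroup.closure s ≤ σ.toMonoidHom.eqLocus (MonoidHom.id G) :=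
    (Subgroup.closure_le _).2 h
  exact hle (hs ▸ Subgroup.mem_top x)

theorem hasRigidSet_of_zpowers_eq_top {G : Type*} [Group G] {a : G}
    (h : Subgroup.zpowers a = ⊤) : HasRigidSet G := by
  refine ⟨{a}, fun σ hσ => σ.eq_self_of_closure_eq_top (s := {a}) ?_ ?_⟩
  · rw [← Subgroup.zpowers_eq_closure, h]
  · rintro _ rfl
    exact hσ rfl

theorem hasRigidSet_of_orderOf_ne {G : Type*} [Group G] {a b : G}
    (h : Subgroup.closure ({a, b} : Set G) = ⊤) (hab : orderOf a ≠ orderOf b) :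
    HasRigidSet G := by
  refine ⟨{a, b}, fun σ hσ => σ.eq_self_of_closure_eq_top h ?_⟩
  rintro x (rfl | rfl)
  · rcases hσ (Set.mem_insert _ _) with h | h
    · exact h
    · exact absurd ((congrArg orderOf h).symm.trans (σ.orderOf_eq x)) hab.symm
  · rcases hσ (Set.mem_insert_of_mem _ rfl) with h | h
    · exact absurd ((congrArg orderOf h).symm.trans (σ.orderOf_eq _)) hab
    · exact h

/-- The characterisation of the quaternion group by a presentation and the order. -/
theorem nonempty_mulEquiv_quaternionGroup {G : Type*} [Group G] [Finite G] {a b : G}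
    (ha : a ^ 4 = 1) (hb : b ^ 2 = a ^ 2) (hba : a * b * a = b)
    (hgen : Subgroup.closure ({a, b} : Set G) = ⊤) (hcard : Nat.card G = 8) :
    Nonempty (G ≃* QuaternionGroup 2) := by
  let p : ZMod (2 * 2) → G := fun i => a ^ i.val
  have hp : ∀ i j, p (i + j) = p i * p j := by
    intro i j
    change a ^ (i + j).val = a ^ i.val * a ^ j.val
    rw [ZMod.val_add, ← pow_add]
    exact (pow_eq_pow_mod _ ha).symm
  have hp1 : p 1 = a := pow_one a
  have hp2 : p 2 = b * b := by
    rw [← pow_two b, hb]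
    rfl
  have hp0 : p 0 = 1 := pow_zero a
  have hpb : ∀ i j, p i * (b * p j) = b * p (j - i) := by
    intro i j
    have h : ∀ n : ℕ, a ^ n * b * a ^ n = b := by
      intro n
      induction n with
      | zero => simp
      | succ n ih =>
        have : a ^ (n + 1) * b * a ^ (n + 1) = a ^ n * (a * b * a) * a ^ n := by group
        rw [this, hba, ih]
    calc p i * (b * p j) = p i * b * p i * p (j - i) := by
          rw [← mul_assoc, mul_assoc _ (p i) (p (j - i)), ← hp, add_sub_cancel]
      _ = b * p (j - i) := by rw [h i.val]
  let f : QuaternionGroup 2 →* G := MonoidHom.mk' (fun q => match q with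
    | .a i => p i
    | .xa i => b * p i) (by
      rintro (i | i) (j | j)
      · exact hp i j
      · exact (hpb i j).symm
      · change b * p (i + j) = b * p i * p j
        rw [hp, mul_assoc]
      · change p ((2 : ℕ) + j - i) = b * p i * (b * p j)
        rw [mul_assoc, hpb, ← mul_assoc, ← hp2, ← hp, add_sub_assoc]
        rfl)
  have hf : Function.Surjective f := by
    rw [← MonoidHom.range_eq_top, ← top_le_iff, ← hgen, Subgroup.closure_le]
    rintro x (rfl | rfl)
    · exact ⟨.a 1, hp1⟩
    · exact ⟨.xa 0, by change x * p 0 = x; rw [hp0, mul_one]⟩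
  have hbij : Function.Bijective f := by
    rw [Nat.bijective_iff_surjective_and_card]
    exact ⟨hf, by rw [hcard, Nat.card_eq_fintype_card, QuaternionGroup.card]⟩
  exact ⟨(MulEquiv.ofBijective f hbij).symm⟩

/-- Without a small rigid set, the group is `⟨a⟩` or has order 8. In the latter case an element `v ∉
⟨a⟩` of order other than 4 makes `{a, v}` a rigid generating set. Otherwise all elements outside
`⟨a⟩` square to `a * a`, and applying this to `b` and `a * b` gives the quaternion relations. -/
theorem hasRigidSet_of_exists_orderOf_eq_four {G : Type*} [Group G] [Finite G]
    (h4 : ∀ v : G, orderOf v ≤ 4) (hex : ∃ a : G, orderOf a = 4)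
    (hQ8 : IsEmpty (G ≃* QuaternionGroup 2)) : HasRigidSet G := by
  by_cases hG : HasSmallRigidSet G
  · exact hG.hasRigidSet
  obtain ⟨a, b, ha, hab⟩ := exists_closure_pair_eq_top hG h4 hex
  by_cases hb : b ∈ Subgroup.zpowers a
  · apply hasRigidSet_of_zpowers_eq_top (a := a)
    rw [← top_le_iff, ← hab, Subgroup.closure_le, Set.insert_subset_iff, Set.singleton_subset_iff]
    exact ⟨Subgroup.mem_zpowers a, hb⟩
  have hcard : Nat.card G = 8 := by
    have h := (orderOf_eq_four_and_card_closure_pair hG ha.ge hb).2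
    rwa [hab, Subgroup.card_top] at h
  by_cases hall : ∃ v, v ∉ Subgroup.zpowers a ∧ orderOf v ≠ 4
  · obtain ⟨v, hv, hv4⟩ := hall
    refine hasRigidSet_of_orderOf_ne (a := a) (b := v) ?_ (by rw [ha]; exact hv4.symm)
    rw [← Subgroup.card_eq_iff_eq_top, hcard,
      (orderOf_eq_four_and_card_closure_pair hG ha.ge hv).2]
  · push Not at hall
    exfalso
    have ha4 : a ^ 4 = 1 := ha ▸ pow_orderOf_eq_one a
    have hsq : ∀ v, v ∉ Subgroup.zpowers a → v * v = a * a := by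
      intro v hv
      refine (sq_eq_one_or_sq_eq_sq hG h4 ha v).resolve_left fun h => ?_
      have := orderOf_le_of_pow_eq_one (x := v) (n := 2) (by norm_num) (by rwa [pow_two])
      have := hall v hv
      omega
    have hb2 := hsq b hb
    have hab2 := hsq (a * b) fun h => hb ((mul_mem_cancel_left (Subgroup.mem_zpowers a)).1 h)
    obtain ⟨e⟩ := nonempty_mulEquiv_quaternionGroup ha4 (by rw [pow_two, pow_two, hb2])
      (by rw [← hb2, ← mul_assoc, mul_left_inj] at hab2; exact hab2) hab hcard
    exact hQ8.false e

/-! ### Element orders at most three -/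

/-- The set `{1, x, t}` bounds `⟨x, t⟩` by 8, so its order is 6 and `t` normalises `⟨x⟩`;
centralising it would produce an element of order 6. -/
theorem conj_eq_inv_of_orderOf {G : Type*} [Group G] [Finite G] (hG : ¬ HasSmallRigidSet G)
    (h3 : ∀ v : G, orderOf v ≤ 3) {x t : G} (hx : orderOf x = 3) (ht : orderOf t = 2) :
    t * x * t⁻¹ = x⁻¹ := by
  classical
  have htx : t ∉ Subgroup.zpowers x := fun h => by
    have := orderOf_dvd_of_mem_zpowers h
    rw [hx, ht] at this
    omega
  have hc : Nat.card (Subgroup.closure ({x, t} : Set G)) ≤ 8 := by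
    by_contra! hc
    refine hG (hasSmallRigidSet_of_orderOf_ne (a := x) (b := t) ?_ ?_ (by omega) hc)
    · rintro rfl
      simp at hx
    · rintro rfl
      simp at ht
  obtain ⟨k, hk, hck⟩ := Subgroup.exists_card_eq_mul (zpowers_lt_closure_pair htx)
  have hcard : Nat.card (Subgroup.closure ({x, t} : Set G))
      = 2 * Nat.card (Subgroup.zpowers x) := by
    rw [Nat.card_zpowers, hx] at hck ⊢
    omega
  have hmem := (Subgroup.sq_mem_and_conj_mem_of_card_eq (zpowers_lt_closure_pair htx).le hcard
    (mem_closure_pair_right x t)).2 x (Subgroup.mem_zpowers x)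
  rw [mem_zpowers_iff_mem_range_orderOf, hx] at hmem
  simp only [Finset.mem_image, Finset.mem_range] at hmem
  obtain ⟨i, hi, h⟩ := hmem
  have hx3 : x ^ 3 = 1 := hx ▸ pow_orderOf_eq_one x
  interval_cases i
  · have : x = 1 := by simpa using h.symm
    rw [this] at hx
    simp at hx
  · have hcomm : Commute x t := by
      rw [pow_one, eq_mul_inv_iff_mul_eq] at h
      exact h
    have h6 := hcomm.orderOf_mul_eq_mul_orderOf_of_coprime (by rw [hx, ht]; norm_num)
    have := h3 (x * t)
    rw [hx, ht] at h6
    omega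
  · rw [← h]
    exact eq_inv_of_mul_eq_one_left (by rw [← pow_succ]; exact hx3)

/-- The set is `{b, b * a, b * d, a}`. Its first three elements are involutions, so `a` is fixed. -/
theorem hasSmallRigidSet_of_inverted {G : Type*} [Group G] [Finite G] {a b d : G}
    (ha : orderOf a = 3) (hb : orderOf b = 2) (hba : b * a * b = a⁻¹)
    (hbd : b * d * b = d⁻¹) (hdab : d ∉ Subgroup.closure ({a, b} : Set G)) :
    HasSmallRigidSet G := by
  classical
  have haL := mem_closure_pair_left a b
  have hbL := mem_closure_pair_right a b
  have hne : ∀ u ∈ Subgroup.closure ({a, b} : Set G), d ≠ u := fun u hu h => hdab (h ▸ hu)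
  have ha3 : a ^ 3 = 1 := ha ▸ pow_orderOf_eq_one a
  have hb2 : b * b = 1 := by rw [← pow_two, ← hb, pow_orderOf_eq_one]
  have ha1 : a ≠ 1 := by
    rintro rfl
    simp at ha
  have hb1 : b ≠ 1 := by
    rintro rfl
    simp at hb
  have ha2 : a⁻¹ ≠ a := fun h => by
    have h2 : a * a = 1 := by rw [← inv_eq_iff_mul_eq_one, h]
    rw [pow_succ, pow_two, h2, one_mul] at ha3
    exact ha1 ha3
  have hd1 : d ≠ 1 := hne 1 (one_mem _)
  have hda : d ≠ a := hne a haL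
  have hdinv : d⁻¹ ≠ a := fun h => hne a⁻¹ (inv_mem haL) (by rw [← h, inv_inv])
  have hba' : a * b * a = b := by
    rw [← mul_right_inj b, ← mul_assoc, ← mul_assoc, hba, hb2, inv_mul_cancel]
  set K := Subgroup.closure ({a, b, d} : Set G) with hK
  have haK : a ∈ K := Subgroup.subset_closure (by simp)
  have hbK : b ∈ K := Subgroup.subset_closure (by simp)
  have hdK : d ∈ K := Subgroup.subset_closure (by simp)
  have hbaK := mul_mem hbK haK
  have hbdK := mul_mem hbK hdK
  have hob : ∀ {u : G}, u * u = 1 → orderOf u ≠ 3 := fun {u} h h' => by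
    have := orderOf_dvd_of_pow_eq_one (x := u) (n := 2) (by rwa [pow_two])
    rw [h'] at this
    omega
  have hba2 : (b * a) * (b * a) = 1 := by rw [← mul_assoc, hba, inv_mul_cancel]
  have hbd2 : (b * d) * (b * d) = 1 := by rw [← mul_assoc, hbd, inv_mul_cancel]
  have hna : ∀ {u : G}, u * u = 1 → u ≠ a := fun {u} h h' => hob h (by rw [h', ha])
  have h4 : ({b, b * a, b * d, a} : Finset G).card = 4 := by
    rw [Finset.card_insert_of_notMem, Finset.card_insert_of_notMem, Finset.card_insert_of_notMem,
      Finset.card_singleton]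
    · simpa using hna hbd2
    · simpa using ⟨hda.symm, hb1⟩
    · simpa using ⟨ha1, hd1, hna hb2⟩
  -- The chain `⟨a⟩ < ⟨a, b⟩ < K` gives at least `3 * 2 * 2`, more than `2 * 4 + 2`.
  have hcard : 12 ≤ Nat.card K := by
    have hab : b ∉ Subgroup.zpowers a := fun h => by
      have := orderOf_dvd_of_mem_zpowers h
      rw [ha, hb] at this
      omega
    obtain ⟨k, hk, h1⟩ := Subgroup.exists_card_eq_mul (zpowers_lt_closure_pair hab)
    obtain ⟨l, hl, h2⟩ := Subgroup.exists_card_eq_mul (closure_pair_lt_closure_triple hdab)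
    rw [Nat.card_zpowers, ha] at h1
    rw [h2, h1]
    nlinarith
  refine hasSmallRigidSet_of_closure {b, b * a, b * d, a} (by omega) K ?_ ?_ (by omega) ?_
  · simp only [Finset.coe_insert, Finset.coe_singleton, Set.insert_subset_iff,
      Set.singleton_subset_iff, SetLike.mem_coe]
    exact ⟨hbK, hbaK, hbdK, haK⟩
  · set T := Subgroup.closure ((({b, b * a, b * d, a} : Finset G)) : Set G)
    have h1 : a ∈ T := Subgroup.subset_closure (by simp)
    have h2 : b ∈ T := Subgroup.subset_closure (by simp)
    have h3 : b * d ∈ T := Subgroup.subset_closure (by simp)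
    rw [Subgroup.closure_le, Set.insert_subset_iff, Set.insert_subset_iff,
      Set.singleton_subset_iff]
    exact ⟨h1, h2, (mul_mem_cancel_left h2).1 h3⟩
  · intro f hmul hinj hf _
    have hf1 := partialHom_one hmul
    have hfa : f a = a := by
      have h := hf a (by simp)
      have ho := orderOf_partialHom hmul hinj haK
      rw [ha] at ho
      simp only [Finset.mem_insert, Finset.mem_singleton] at h
      rcases h with h | h | h | h
      · exact absurd ho (h ▸ hob hb2)
      · exact absurd ho (h ▸ hob hba2)
      · exact absurd ho (h ▸ hob hbd2)
      · exact h
    have hinv : ∀ u ∈ K, u * u = 1 → f u ∈ ({b, b * a, b * d, a} : Finset G) →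
        f u = b ∨ f u = b * a ∨ f u = b * d := by
      intro u hu hu2 h
      have h2 : f u * f u = 1 := by rw [← hmul u hu u hu, hu2, hf1]
      simp only [Finset.mem_insert, Finset.mem_singleton] at h
      rcases h with h | h | h | h
      · exact Or.inl h
      · exact Or.inr (Or.inl h)
      · exact Or.inr (Or.inr h)
      · exact absurd h (hna h2)
    have hfb := hinv b hbK hb2 (hf _ (by simp))
    have hfba := hinv (b * a) hbaK hba2 (hf _ (by simp))
    have hfbd := hinv (b * d) hbdK hbd2 (hf _ (by simp))
    -- Among the ordered products of two of the involutions, only `b * (b * a)` equals `a`; this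
    -- fixes both factors.
    have hprod : f b * f (b * a) = a := by
      rw [← hmul b hbK _ hbaK, ← mul_assoc, hb2, one_mul, hfa]
    have hboth : f b = b ∧ f (b * a) = b * a := by
      rcases hfb with h1 | h1 | h1 <;> rcases hfba with h2 | h2 | h2 <;> rw [h1, h2] at hprod
      · exact absurd (hprod.symm.trans hb2) ha1
      · exact ⟨h1, h2⟩
      · rw [← mul_assoc, hb2, one_mul] at hprod
        exact absurd hprod hda
      · exact absurd (hba.symm.trans hprod) ha2
      · exact absurd (hprod.symm.trans hba2) ha1
      · rw [← mul_assoc, hba, inv_mul_eq_iff_eq_mul] at hprod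
        exact absurd hprod (hne _ (mul_mem haL haL))
      · exact absurd (hbd.symm.trans hprod) hdinv
      · rw [← mul_assoc, hbd, mul_eq_right, inv_eq_one] at hprod
        exact absurd hprod hd1
      · exact absurd (hprod.symm.trans hbd2) ha1
    have hfbd' : f (b * d) = b * d := by
      rcases hfbd with h | h | h
      · have := hinj _ hbdK _ hbK (h.trans hboth.1.symm)
        exact absurd (mul_eq_left.1 this) hd1
      · have := hinj _ hbdK _ hbaK (h.trans hboth.2.symm)
        exact absurd (mul_left_cancel this) hda
      · exact h
    simp only [Finset.mem_insert, Finset.mem_singleton]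
    rintro y (rfl | rfl | rfl | rfl)
    exacts [hboth.1, hboth.2, hfbd', hfa]

theorem hasRigidSet_of_orderOf_two_three {G : Type*} [Group G] [Finite G]
    (h3 : ∀ v : G, orderOf v ≤ 3) {a b : G} (ha : orderOf a = 3) (hb : orderOf b = 2) :
    HasRigidSet G := by
  by_cases hG : HasSmallRigidSet G
  · exact hG.hasRigidSet
  by_cases htop : Subgroup.closure ({a, b} : Set G) = ⊤
  · exact hasRigidSet_of_orderOf_ne htop (by omega)
  exfalso
  have hinv : ∀ {x t : G}, orderOf x = 3 → orderOf t = 2 → t * x * t⁻¹ = x⁻¹ :=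
    fun hx ht => conj_eq_inv_of_orderOf hG h3 hx ht
  have hord : ∀ v : G, v ≠ 1 → orderOf v = 2 ∨ orderOf v = 3 := by
    intro v hv
    have h1 : orderOf v ≠ 1 := by rwa [Ne, orderOf_eq_one_iff]
    have h2 := orderOf_pos v
    have := h3 v
    omega
  have hbinv : b⁻¹ = b := inv_eq_of_mul_eq_one_left (by rw [← pow_two, ← hb, pow_orderOf_eq_one])
  obtain ⟨c, hc⟩ := exists_notMem_of_ne_top htop
  -- If `c` is an involution, `c * b` centralises `a`, because both factors invert it. So `c * b` is
  -- no involution, since that would invert `a` too, and must have order 3.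
  obtain ⟨d, hd, hdab⟩ : ∃ d, orderOf d = 3 ∧ d ∉ Subgroup.closure ({a, b} : Set G) := by
    have hc1 : c ≠ 1 := by
      rintro rfl
      exact hc (one_mem _)
    rcases hord c hc1 with h | h
    · have hcb : c * b ∉ Subgroup.closure ({a, b} : Set G) := fun h' =>
        hc ((mul_mem_cancel_right (mem_closure_pair_right a b)).1 h')
      refine ⟨c * b, (hord _ ?_).resolve_left fun h2 => ?_, hcb⟩
      · intro h'
        exact hcb (h' ▸ one_mem _)
      · have h4 := hinv ha h2
        have h5 : c * b * a * (c * b)⁻¹ = a := by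
          calc c * b * a * (c * b)⁻¹ = c * (b * a * b⁻¹) * c⁻¹ := by group
            _ = (c * a * c⁻¹)⁻¹ := by rw [hinv ha hb]; group
            _ = a := by rw [hinv ha h, inv_inv]
        have h6 : a ^ 2 = 1 := by
          rw [pow_two, ← inv_eq_iff_mul_eq_one, ← h4, h5]
        exact pow_ne_one_of_lt_orderOf (by norm_num) (by omega) h6
    · exact ⟨c, h, hc⟩
  refine hG (hasSmallRigidSet_of_inverted ha hb ?_ ?_ hdab)
  · simpa only [hbinv] using hinv ha hb
  · simpa only [hbinv] using hinv hd hb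

/-- The set is `{a, b, a * b}`: among ordered pairs of distinct elements, only `(a, b)` has its
product in the set. -/
theorem hasSmallRigidSet_of_exponent_three {G : Type*} [Group G] [Finite G]
    (h3 : ∀ v : G, v ^ 3 = 1) {a b : G} (hab : ¬ Commute a b) : HasSmallRigidSet G := by
  classical
  have ha1 : a ≠ 1 := fun h => hab (h ▸ Commute.one_left b)
  have hb1 : b ≠ 1 := fun h => hab (h ▸ Commute.one_right a)
  have hne : a ≠ b := fun h => hab (h ▸ Commute.refl a)
  have hsq : ∀ {v : G}, v ≠ 1 → v * v ≠ 1 := fun {v} hv h => hv (by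
    have := h3 v
    rwa [pow_succ, pow_two, h, one_mul] at this)
  -- From `(x * y) ^ 3 = 1` and `x * y * x = y` it follows that `y * y * x * y = 1 = y * y * y`,
  -- whence `x = 1`.
  have haba : ∀ {x y : G}, x ≠ 1 → x * y * x ≠ y := fun {x y} hx h => hx (by
    have h1 : (x * y * x) * (y * x * y) = 1 := by
      rw [← h3 (x * y)]
      simp only [pow_succ, pow_zero, one_mul, mul_assoc]
    have h2 : y * y * y = 1 := by rw [← pow_two, ← pow_succ, h3]
    rw [h, ← mul_assoc, ← mul_assoc] at h1
    rw [mul_eq_one_iff_eq_inv, ← inv_eq_of_mul_eq_one_left (b := y) (a := y * y) h2] at h1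
    exact mul_eq_left.1 h1)
  have hab1 : a * b ≠ 1 := fun h => hab (by
    rw [mul_eq_one_iff_eq_inv.1 h]
    exact (Commute.refl b).inv_left)
  have hcard3 : ({a, b, a * b} : Finset G).card = 3 := by
    rw [Finset.card_eq_three]
    exact ⟨_, _, _, hne, fun h => hb1 (left_eq_mul.1 h), fun h => ha1 (right_eq_mul.1 h), rfl⟩
  have haK := mem_closure_pair_left a b
  have hbK := mem_closure_pair_right a b
  set K := Subgroup.closure ({a, b} : Set G) with hK
  have habK := mul_mem haK hbK
  have hcard : 9 ≤ Nat.card K := by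
    have hp : IsPGroup 3 K := fun g => ⟨1, Subtype.ext (by simpa using h3 g)⟩
    have : Fact (Nat.Prime 3) := ⟨Nat.prime_three⟩
    obtain ⟨n, hn⟩ := IsPGroup.iff_card.1 hp
    have hbz : b ∉ Subgroup.zpowers a := by
      rintro ⟨k, rfl⟩
      exact hab ((Commute.refl a).zpow_right k)
    obtain ⟨k, hk, h1⟩ := Subgroup.exists_card_eq_mul (zpowers_lt_closure_pair hbz)
    rw [Nat.card_zpowers, orderOf_eq_prime (h3 a) ha1, ← hK] at h1
    rcases n with _ | _ | n
    · omega
    · omega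
    · rw [hn, pow_succ, pow_succ]
      have := Nat.one_le_pow n 3 (by norm_num)
      omega
  refine hasSmallRigidSet_of_closure {a, b, a * b} (by omega) K ?_ ?_ (by omega) ?_
  · simp only [Finset.coe_insert, Finset.coe_singleton, Set.insert_subset_iff,
      Set.singleton_subset_iff, SetLike.mem_coe]
    exact ⟨haK, hbK, habK⟩
  · apply Subgroup.closure_mono
    simp [Set.insert_subset_iff]
  · intro f hmul hinj hf _
    have h1 := hf a (by simp)
    have h2 := hf b (by simp)
    have h4 := hf (a * b) (by simp)
    have hfne : f a ≠ f b := fun h => hne (hinj _ haK _ hbK h)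
    have hfa1 := partialHom_ne_one hmul hinj haK ha1
    have hfb1 := partialHom_ne_one hmul hinj hbK hb1
    have hboth : f a = a ∧ f b = b := by
      rw [hmul _ haK _ hbK] at h4
      simp only [Finset.mem_insert, Finset.mem_singleton] at h1 h2 h4
      rcases h1 with h1 | h1 | h1 <;> rcases h2 with h2 | h2 | h2 <;> rw [h1, h2] at h4 hfne
      · exact absurd rfl hfne
      · exact ⟨h1, h2⟩
      · rcases h4 with h | h | h
        · exact absurd (mul_eq_left.1 h) hab1
        · rw [← mul_assoc, mul_eq_right] at h
          exact absurd h (hsq ha1)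
        · exact absurd (mul_eq_right.1 h) ha1
      · rcases h4 with h | h | h
        · exact absurd (mul_eq_right.1 h) hb1
        · exact absurd (mul_eq_left.1 h) ha1
        · exact absurd h.symm hab
      · exact absurd rfl hfne
      · rcases h4 with h | h | h
        · rw [← mul_assoc] at h
          exact absurd h (haba hb1)
        · exact absurd (mul_eq_left.1 h) hab1
        · exact absurd (mul_eq_right.1 h) hb1
      · rcases h4 with h | h | h
        · exact absurd (mul_eq_right.1 h) hab1
        · exact absurd h (haba ha1)
        · exact absurd (mul_eq_left.1 h) ha1
      · rcases h4 with h | h | h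
        · rw [mul_assoc, mul_eq_left] at h
          exact absurd h (hsq hb1)
        · exact absurd (mul_eq_right.1 h) hab1
        · exact absurd (mul_eq_left.1 h) hb1
      · exact absurd rfl hfne
    simp only [Finset.mem_insert, Finset.mem_singleton]
    rintro y (rfl | rfl | rfl)
    exacts [hboth.1, hboth.2, by rw [hmul _ haK _ hbK, hboth.1, hboth.2]]

/-! ### Elementary abelian groups -/

theorem nonempty_mulEquiv_of_exponent {G : Type*} [CommGroup G] [Finite G] (p : ℕ)
    [Fact p.Prime] (h : ∀ v : G, v ^ p = 1) :
    ∃ k : ℕ, Nonempty (G ≃* (Fin k → Multiplicative (ZMod p))) := by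
  let _ : Module (ZMod p) (Additive G) := AddCommGroup.zmodModule (n := p) fun x => h x.toMul
  have : Module.Finite (ZMod p) (Additive G) := Module.Finite.of_finite
  let e := (Module.finBasis (ZMod p) (Additive G)).equivFun
  exact ⟨_, ⟨{ toFun := fun g i => .ofAdd (e (.ofMul g) i)
               invFun := fun v => (e.symm fun i => (v i).toAdd).toMul
               left_inv := fun g => by simp
               right_inv := fun v => by ext i; simp
               map_mul' := fun g g' => by ext i; simp }⟩⟩

/-- Automorphisms preserving `Y` preserve weighted numbers of pairs in `Y` with prescribed
ratio. -/
theorem sum_filter_eq_of_mapsTo {G : Type*} [Group G] [DecidableEq G] {Y : Finset G}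
    (σ : G ≃* G) (hσ : ∀ y ∈ Y, σ y ∈ Y) (g : G → ℕ) (hg : ∀ y ∈ Y, g (σ y) = g y) (y : G) :
    ∑ w ∈ Y with σ y * w ∈ Y, g w = ∑ w ∈ Y with y * w ∈ Y, g w := by
  have himage : Y.image σ = Y := by
    refine Finset.eq_of_subset_of_card_le (Finset.image_subset_iff.2 hσ) ?_
    rw [Finset.card_image_of_injective _ σ.injective]
  have hmem : ∀ w, σ w ∈ Y ↔ w ∈ Y := fun w => by
    constructor
    · intro h
      rw [← himage, Finset.mem_image] at h
      obtain ⟨u, hu, huw⟩ := h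
      rwa [← σ.injective huw]
    · exact hσ w
  symm
  refine Finset.sum_bij (fun w _ => σ w) ?_ (fun _ _ _ _ h => σ.injective h) ?_ ?_
  · intro w hw
    rw [Finset.mem_filter] at hw ⊢
    exact ⟨hσ w hw.1, by rw [← map_mul]; exact hσ _ hw.2⟩
  · intro w hw
    rw [Finset.mem_filter] at hw
    obtain ⟨u, hu, rfl⟩ := Finset.mem_image.1 (himage.symm ▸ hw.1)
    refine ⟨u, ?_, rfl⟩
    rw [Finset.mem_filter]
    exact ⟨hu, (hmem _).1 (by rw [map_mul]; exact hw.2)⟩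
  · intro w hw
    exact (hg w (Finset.mem_filter.1 hw).1).symm

theorem fixed_mul {G : Type*} [Group G] (σ : G ≃* G) {x y : G} (hx : σ x = x) (hy : σ y = y) :
    σ (x * y) = x * y := by
  rw [map_mul, hx, hy]

theorem fixed_pow {G : Type*} [Group G] (σ : G ≃* G) {x : G} (hx : σ x = x) (n : ℕ) :
    σ (x ^ n) = x ^ n := by
  rw [map_pow, hx]

/-- The vector with entries in `ZMod p`, as an element of a multiplicatively written group. -/
def multVec {n p : ℕ} (v : Fin n → ZMod p) : Fin n → Multiplicative (ZMod p) :=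
  fun i => .ofAdd (v i)

/-- A rigid set of the elementary abelian group of order 27. -/
def rigidSetThree : Finset (Fin 3 → Multiplicative (ZMod 3)) :=
  {multVec ![0, 0, 1], multVec ![1, 0, 1], multVec ![1, 2, 0], multVec ![1, 2, 1],
    multVec ![1, 2, 2], multVec ![2, 2, 1]}

/-- For `y` in the set, the number of pairs of ratio `y` is invariant. On three elements that
generate the group this number is taken by no other element of the set, so these are fixed. -/
theorem hasSmallRigidSet_three : HasSmallRigidSet (Fin 3 → Multiplicative (ZMod 3)) := by
  have hcard : rigidSetThree.card = 6 := by decide +kernel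
  refine ⟨rigidSetThree, ?_, ?_, fun σ hσ => ?_⟩
  · rw [Set.ncard_coe_finset, hcard]
    norm_num
  · rw [Set.ncard_coe_finset, hcard, Nat.card_eq_fintype_card, Fintype.card_pi_const,
      Fintype.card_multiplicative, ZMod.card]
    norm_num
  · have hg := sum_filter_eq_of_mapsTo σ hσ (fun _ => 1) fun _ _ => rfl
    have hfix : ∀ y ∈ rigidSetThree, (∀ u ∈ rigidSetThree,
        ∑ w ∈ rigidSetThree with u * w ∈ rigidSetThree, 1
          = ∑ w ∈ rigidSetThree with y * w ∈ rigidSetThree, 1 → u = y) → σ y = y :=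
      fun y hy h => h _ (hσ hy) (hg y)
    have h1 := hfix (multVec ![0, 0, 1]) (by decide +kernel) (by decide +kernel)
    have h2 := hfix (multVec ![1, 2, 0]) (by decide +kernel) (by decide +kernel)
    have h3 := hfix (multVec ![2, 2, 1]) (by decide +kernel) (by decide +kernel)
    have hgen : ∀ x : Fin 3 → Multiplicative (ZMod 3), ∃ i j k : Fin 3,
        x = multVec ![0, 0, 1] ^ (i : ℕ) * multVec ![1, 2, 0] ^ (j : ℕ)
          * multVec ![2, 2, 1] ^ (k : ℕ) := by decide +kernel
    intro x
    obtain ⟨i, j, k, rfl⟩ := hgen x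
    exact fixed_mul σ (fixed_mul σ (fixed_pow σ h1 i) (fixed_pow σ h2 j)) (fixed_pow σ h3 k)

/-- A rigid set of the elementary abelian group of order 32. -/
def rigidSetFive : Finset (Fin 5 → Multiplicative (ZMod 2)) :=
  {multVec ![1, 1, 0, 0, 0], multVec ![0, 1, 1, 0, 0], multVec ![1, 0, 0, 1, 0],
    multVec ![0, 1, 0, 1, 0], multVec ![0, 0, 1, 0, 1], multVec ![1, 0, 1, 0, 1],
    multVec ![1, 1, 1, 0, 1], multVec ![0, 0, 0, 1, 1], multVec ![1, 0, 0, 1, 1],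
    multVec ![1, 1, 0, 1, 1], multVec ![1, 0, 1, 1, 1], multVec ![1, 1, 1, 1, 1]}

/-- The number of pairs in `rigidSetFive` with ratio `y`. -/
def pairCountFive (y : Fin 5 → Multiplicative (ZMod 2)) : ℕ :=
  ∑ w ∈ rigidSetFive with y * w ∈ rigidSetFive, 1

/-- The number of pairs in `rigidSetFive` with ratio `y`, weighted by `pairCountFive`. -/
def weightedPairCountFive (y : Fin 5 → Multiplicative (ZMod 2)) : ℕ :=
  ∑ w ∈ rigidSetFive with y * w ∈ rigidSetFive, pairCountFive w

/-- The pair counts are themselves invariant, so they may serve as weights in a second round of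
counting; the weighted counts single out five generators. -/
theorem hasSmallRigidSet_five : HasSmallRigidSet (Fin 5 → Multiplicative (ZMod 2)) := by
  have hcard : rigidSetFive.card = 12 := by decide +kernel
  refine ⟨rigidSetFive, ?_, ?_, fun σ hσ => ?_⟩
  · rw [Set.ncard_coe_finset, hcard]
    norm_num
  · rw [Set.ncard_coe_finset, hcard, Nat.card_eq_fintype_card, Fintype.card_pi_const,
      Fintype.card_multiplicative, ZMod.card]
    norm_num
  · have hg : ∀ y, weightedPairCountFive (σ y) = weightedPairCountFive y :=
      sum_filter_eq_of_mapsTo σ hσ _ fun y _ =>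
        sum_filter_eq_of_mapsTo σ hσ (fun _ => 1) (fun _ _ => rfl) y
    have hfix : ∀ y ∈ rigidSetFive, (∀ u ∈ rigidSetFive,
        weightedPairCountFive u = weightedPairCountFive y → u = y) → σ y = y :=
      fun y hy h => h _ (hσ hy) (hg y)
    have h1 := hfix (multVec ![1, 1, 0, 0, 0]) (by decide +kernel) (by decide +kernel)
    have h2 := hfix (multVec ![0, 1, 1, 0, 0]) (by decide +kernel) (by decide +kernel)
    have h3 := hfix (multVec ![0, 0, 1, 0, 1]) (by decide +kernel) (by decide +kernel)
    have h4 := hfix (multVec ![1, 0, 0, 1, 1]) (by decide +kernel) (by decide +kernel)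
    have h5 := hfix (multVec ![1, 1, 0, 1, 1]) (by decide +kernel) (by decide +kernel)
    have hgen : ∀ x : Fin 5 → Multiplicative (ZMod 2), ∃ i j k l m : Fin 2,
        x = multVec ![1, 1, 0, 0, 0] ^ (i : ℕ) * multVec ![0, 1, 1, 0, 0] ^ (j : ℕ)
          * multVec ![0, 0, 1, 0, 1] ^ (k : ℕ) * multVec ![1, 0, 0, 1, 1] ^ (l : ℕ)
          * multVec ![1, 1, 0, 1, 1] ^ (m : ℕ) := by decide +kernel
    intro x
    obtain ⟨i, j, k, l, m, rfl⟩ := hgen x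
    exact fixed_mul σ (fixed_mul σ (fixed_mul σ (fixed_mul σ (fixed_pow σ h1 i) (fixed_pow σ h2 j))
      (fixed_pow σ h3 k)) (fixed_pow σ h4 l)) (fixed_pow σ h5 m)

/-- The embedding of `Mᵐ` into `Mᵏ`, for `m ≤ k`, by extending vectors by `1`. -/
def extendOne (M : Type*) [MulOneClass M] (m k : ℕ) : (Fin m → M) →* (Fin k → M) where
  toFun v i := if h : (i : ℕ) < m then v ⟨i, h⟩ else 1
  map_one' := by
    ext i
    simp
  map_mul' v w := by
    ext i
    by_cases h : (i : ℕ) < m <;> simp [h]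

theorem extendOne_injective (M : Type*) [MulOneClass M] {m k : ℕ} (h : m ≤ k) :
    Function.Injective (extendOne M m k) := by
  intro v w hvw
  ext i
  have := congrFun hvw ⟨i, i.2.trans_le h⟩
  simpa [extendOne] using this

/-- A finite abelian group of prime exponent `p` has a rigid set, unless its rank lies strictly
between `1` and the rank `m` of some elementary abelian `p`-group with a small rigid set. -/
theorem hasRigidSet_of_prime_exponent {G : Type*} [CommGroup G] [Finite G] (p : ℕ)
    [Fact p.Prime] (h : ∀ v : G, v ^ p = 1) (m : ℕ)
    (hm : HasSmallRigidSet (Fin m → Multiplicative (ZMod p)))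
    (hG : ∀ k, 2 ≤ k → k < m → IsEmpty (G ≃* (Fin k → Multiplicative (ZMod p)))) :
    HasRigidSet G := by
  obtain ⟨k, ⟨e⟩⟩ := nonempty_mulEquiv_of_exponent p h
  by_cases hk : m ≤ k
  · have : Finite (Fin k → Multiplicative (ZMod p)) := Finite.of_equiv G e.toEquiv
    exact ((hm.of_injective _ (extendOne_injective _ hk)).of_mulEquiv e.symm).hasRigidSet
  · have hk2 : k < 2 := by
      by_contra hn
      exact (hG k (by omega) (by omega)).false e
    have hcard : Nat.card G = p ^ k := by
      rw [Nat.card_congr e.toEquiv, Nat.card_eq_fintype_card, Fintype.card_pi_const,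
        Fintype.card_multiplicative, ZMod.card]
    interval_cases k
    · refine hasRigidSet_of_zpowers_eq_top (a := 1) ?_
      rw [← Subgroup.card_eq_iff_eq_top, Nat.card_zpowers, hcard, orderOf_one, pow_zero]
    · have : IsCyclic G := isCyclic_of_prime_card (p := p) (by rw [hcard, pow_one])
      obtain ⟨g, hg⟩ := IsCyclic.exists_generator (α := G)
      exact hasRigidSet_of_zpowers_eq_top ((Subgroup.eq_top_iff' _).2 hg)

/-! ### Assembly and return to Cayley graphs -/

/-- Every finite group has a subset that is preserved by no automorphism except the identity, with
exactly five possible exceptions. -/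
theorem hasRigidSet_of_isEmpty {H : Type*} [Group H] [Finite H]
    (hC22 : IsEmpty (H ≃* (Fin 2 → Multiplicative (ZMod 2))))
    (hC23 : IsEmpty (H ≃* (Fin 3 → Multiplicative (ZMod 2))))
    (hC32 : IsEmpty (H ≃* (Fin 2 → Multiplicative (ZMod 3))))
    (hC24 : IsEmpty (H ≃* (Fin 4 → Multiplicative (ZMod 2))))
    (hQ8 : IsEmpty (H ≃* QuaternionGroup 2)) : HasRigidSet H := by
  by_cases hH : HasSmallRigidSet H
  · exact hH.hasRigidSet
  by_cases h4 : ∀ v : H, orderOf v ≤ 4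
  swap
  · push Not at h4
    obtain ⟨a, ha⟩ := h4
    refine hasRigidSet_of_zpowers_eq_top ((Subgroup.eq_top_iff' (Subgroup.zpowers a)).2 ?_)
    intro b
    by_contra hb
    have := (orderOf_eq_four_and_card_closure_pair hH ha.le hb).1
    omega
  by_cases hex4 : ∃ a : H, orderOf a = 4
  · exact hasRigidSet_of_exists_orderOf_eq_four h4 hex4 hQ8
  push Not at hex4
  have h3 : ∀ v : H, orderOf v ≤ 3 := fun v => by
    have := h4 v
    have := hex4 v
    omega
  by_cases hex3 : ∃ a : H, orderOf a = 3
  · obtain ⟨a, ha⟩ := hex3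
    by_cases hex2 : ∃ b : H, orderOf b = 2
    · obtain ⟨b, hb⟩ := hex2
      exact hasRigidSet_of_orderOf_two_three h3 ha hb
    · push Not at hex2
      have hpow : ∀ v : H, v ^ 3 = 1 := fun v => by
        rw [← orderOf_dvd_iff_pow_eq_one]
        have h1 := h3 v
        have h2 := hex2 v
        have h5 := orderOf_pos v
        interval_cases orderOf v <;> omega
      by_cases hcomm : ∀ x y : H, Commute x y
      · let _ : CommGroup H := { ‹Group H› with mul_comm := fun x y => (hcomm x y).eq }
        have : Fact (Nat.Prime 3) := ⟨Nat.prime_three⟩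
        refine hasRigidSet_of_prime_exponent 3 hpow 3 hasSmallRigidSet_three fun k hk hk3 => ?_
        obtain rfl : k = 2 := by omega
        exact hC32
      · push Not at hcomm
        obtain ⟨x, y, hxy⟩ := hcomm
        exact absurd (hasSmallRigidSet_of_exponent_three hpow hxy) hH
  · push Not at hex3
    have hpow : ∀ v : H, v ^ 2 = 1 := fun v => by
      rw [← orderOf_dvd_iff_pow_eq_one]
      have h1 := h3 v
      have h2 := hex3 v
      have h5 := orderOf_pos v
      interval_cases orderOf v <;> omega
    have hcomm : ∀ x y : H, Commute x y := fun x y => by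
      have hinv : ∀ v : H, v⁻¹ = v := fun v =>
        inv_eq_of_mul_eq_one_left (by rw [← pow_two, hpow])
      have h := hinv (x * y)
      rw [mul_inv_rev, hinv, hinv] at h
      exact h.symm
    let _ : CommGroup H := { ‹Group H› with mul_comm := fun x y => (hcomm x y).eq }
    have : Fact (Nat.Prime 2) := ⟨Nat.prime_two⟩
    refine hasRigidSet_of_prime_exponent 2 hpow 5 hasSmallRigidSet_five fun k hk hk5 => ?_
    interval_cases k
    exacts [hC22, hC23, hC24]

/-- An automorphism of a normal Cayley graph that fixes the identity is a group automorphism. -/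
theorem IsNormalCayley.map_mul {H : Type*} [Group H] {S : Set H} {h1 : (1 : H) ∉ S}
    {hinv : ∀ s ∈ S, s⁻¹ ∈ S} (hnormal : IsNormalCayley S h1 hinv)
    (σ : cayleyGraph S h1 hinv ≃g cayleyGraph S h1 hinv) (hσ : σ 1 = 1) (x y : H) :
    σ (x * y) = σ x * σ y := by
  -- Conjugating `v ↦ v * y` by `σ` gives a right translation `v ↦ v * b⁻¹`; evaluation at `σ 1 = 1`
  -- identifies `b⁻¹` as `σ y`. The inverses come from the convention in `rightTranslation`.
  obtain ⟨b, hb⟩ := hnormal.conj_mem (rightTranslation S h1 hinv y⁻¹) ⟨_, rfl⟩ σ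
  have key : ∀ v, σ (v * y) = σ v * b⁻¹ := by
    intro v
    have h := congrArg (fun τ : cayleyGraph S h1 hinv ≃g cayleyGraph S h1 hinv => τ (σ v)) hb
    have h2 : σ v * b⁻¹ = σ (σ.symm (σ v) * y⁻¹⁻¹) := h
    rw [σ.symm_apply_apply, inv_inv] at h2
    exact h2.symm
  have hy : σ y = b⁻¹ := by simpa [hσ] using key 1
  rw [key x, hy]

theorem mainTheorem3 {H : Type*} [Group H] [Finite H] (S : Set H) (h1 : (1 : H) ∉ S)
    (hinv : ∀ s ∈ S, s⁻¹ ∈ S) (hnormal : IsNormalCayley S h1 hinv)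
    (hC22 : IsEmpty (H ≃* (Fin 2 → Multiplicative (ZMod 2))))
    (hC23 : IsEmpty (H ≃* (Fin 3 → Multiplicative (ZMod 2))))
    (hC32 : IsEmpty (H ≃* (Fin 2 → Multiplicative (ZMod 3))))
    (hC24 : IsEmpty (H ≃* (Fin 4 → Multiplicative (ZMod 2))))
    (hQ8 : IsEmpty (H ≃* QuaternionGroup 2)) :
    distinguishingNumber (cayleyGraph S h1 hinv) ≤ 3 := by

  classical
  obtain ⟨Y, hY⟩ := hasRigidSet_of_isEmpty hC22 hC23 hC32 hC24 hQ8
  -- The label `0` occurs only at `1`, so a label-preserving automorphism fixes `1`; whether `1`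
  -- lies in `Y` does not matter.
  refine iInf₂_le 3 ⟨fun x => if x = 1 then 0 else if x ∈ Y then 1 else 2, fun σ hσ => ?_⟩
  by_contra! hlabel
  have hσ1 : σ 1 = 1 := by
    have h := hlabel 1
    by_contra hn
    rw [if_pos rfl, if_neg hn] at h
    split_ifs at h <;> exact absurd h (by decide)
  have hmaps : Set.MapsTo σ Y Y := by
    intro y hy
    by_cases hy1 : y = 1
    · rw [hy1, hσ1, ← hy1]
      exact hy
    · have h := hlabel y
      rw [if_neg hy1, if_pos hy] at h
      by_contra hn
      rw [if_neg hn] at h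
      split_ifs at h <;> exact absurd h (by decide)
  refine hσ (RelIso.ext fun x => ?_)
  exact hY (MulEquiv.mk' σ.toEquiv (hnormal.map_mul σ hσ1)) hmaps x
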